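/- Let $\phi(x)$ be any formula of the language $\{\in\}$ of set theory in one free variable, and let $X_\phi=\{x:\phi(x)\}$ be the class it defines. Call two sets $y,z$ *comparable* if $|y|\le|z|$ or $|z|\le|y|$, that is, if there is an injection from $y$ to $z$ or one from $z$ to $y$. Let $\mathrm{Comp}_\omega$ be the sentence "every set of cardinality $\aleph_0$ contains two distinct comparable elements", and let $\mathrm{Comp}_\phi$ be the sentence "if $X_\phi$ is a proper class, then it contains two distinct comparable elements". Then the following is a theorem of $\mathrm{ZF}$ (equivalently, it holds in every model of $\mathrm{ZF}$): if $X_\phi$ is a proper class, then $\mathrm{Comp}_\omega\rightarrow \mathrm{Comp}_\phi$. -/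

import Mathlib

open FirstOrder FirstOrder.Language

namespace FirstOrderZF

/-- The only non-logical symbol of the language of set theory: the binary relation symbol `∈`. -/
inductive MemSymbol : ℕ → Type
  | mem : MemSymbol 2

/-- The first-order language `{∈}` of set theory (equality is a logical symbol). -/
def setLang : FirstOrder.Language.{0, 0} := ⟨fun _ => Empty, MemSymbol⟩

/-- Formulas of set theory whose free variables are among the `n` variables indexed by `Fin n`.
In particular `Fml 0` is the type of sentences. -/
abbrev Fml (n : ℕ) : Type := setLang.BoundedFormula Empty n

/-- A variable in scope, viewed in the scope of one more quantifier. -/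
abbrev up {n : ℕ} (x : Fin n) : Fin (n + 1) := Fin.castSucc x

/-- `∀ z, body z`, the bound variable being the new last variable. -/
def all {n : ℕ} (body : Fin (n + 1) → Fml (n + 1)) : Fml n := ∀' (body (Fin.last n))

/-- `∃ z, body z`, the bound variable being the new last variable. -/
def ex {n : ℕ} (body : Fin (n + 1) → Fml (n + 1)) : Fml n := ∃' (body (Fin.last n))

/-- `x ∈ y` -/
def mem {n : ℕ} (x y : Fin n) : Fml n :=
  Relations.boundedFormula₂ (L := setLang) MemSymbol.mem
    (Term.var (Sum.inr x)) (Term.var (Sum.inr y))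

/-- `x = y` -/
def eq {n : ℕ} (x y : Fin n) : Fml n :=
  Term.bdEqual (L := setLang) (Term.var (Sum.inr x)) (Term.var (Sum.inr y))

/-- The formula `φ`, with each of its free variables `a` replaced by the variable `g a`. -/
def inst {α : Type} {n : ℕ} (φ : setLang.Formula α) (g : α → Fin n) : Fml n :=
  BoundedFormula.relabel (n := n) (k := 0) (fun a => Sum.inr (g a)) φ

/-! ### Basic set-theoretic predicates -/

/-- `x ⊆ y` -/
def subset {n : ℕ} (x y : Fin n) : Fml n := all fun z => mem z (up x) ⟹ mem z (up y)

/-- `x = ∅` -/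
def isEmpty {n : ℕ} (x : Fin n) : Fml n := all fun z => ∼(mem z (up x))

/-- `p = {a, b}` -/
def isPair {n : ℕ} (p a b : Fin n) : Fml n :=
  all fun z => mem z (up p) ⇔ (eq z (up a) ⊔ eq z (up b))

/-- `p = ⟨a, b⟩ = {{a}, {a, b}}` -/
def isOrdPair {n : ℕ} (p a b : Fin n) : Fml n :=
  ex fun s => isPair s (up a) (up a) ⊓
    ex fun t => isPair t (up (up a)) (up (up b)) ⊓ isPair (up (up p)) (up s) t

/-- `s = x ∪ {x}` -/
def isSucc {n : ℕ} (s x : Fin n) : Fml n :=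
  all fun z => mem z (up s) ⇔ (mem z (up x) ⊔ eq z (up x))

/-- `∅ ∈ w`, and `x ∪ {x} ∈ w` for every `x ∈ w`. -/
def isInductive {n : ℕ} (w : Fin n) : Fml n :=
  (ex fun e => isEmpty e ⊓ mem e (up w)) ⊓
    all fun x => mem x (up w) ⟹ ex fun s => isSucc s (up x) ⊓ mem s (up (up w))

/-- `w = ω`: `w` is the least inductive set. -/
def isOmega {n : ℕ} (w : Fin n) : Fml n :=
  isInductive w ⊓ all fun v => isInductive v ⟹ subset (up w) v

/-! ### Functions and cardinalities -/

/-- `⟨a, b⟩ ∈ f` -/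
def pairMem {n : ℕ} (a b f : Fin n) : Fml n :=
  ex fun p => isOrdPair p (up a) (up b) ⊓ mem p (up f)

/-- `f ⊆ x × y` -/
def isRelation {n : ℕ} (f x y : Fin n) : Fml n :=
  all fun p => mem p (up f) ⟹
    ex fun a => mem a (up (up x)) ⊓
      ex fun b => mem b (up (up (up y))) ⊓ isOrdPair (up (up p)) (up a) b

/-- `f` is a function from `x` to `y`. -/
def isFunction {n : ℕ} (f x y : Fin n) : Fml n :=
  isRelation f x y ⊓
    all fun a => mem a (up x) ⟹
      ex fun b => pairMem (up a) b (up (up f)) ⊓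
        all fun c => pairMem (up (up a)) c (up (up (up f))) ⟹ eq c (up b)

/-- `f` is an injective function from `x` to `y`. -/
def isInjection {n : ℕ} (f x y : Fin n) : Fml n :=
  isFunction f x y ⊓
    all fun a => all fun b => all fun c =>
      (pairMem (up (up a)) c (up (up (up f))) ⊓ pairMem (up b) c (up (up (up f)))) ⟹
        eq (up (up a)) (up b)

/-- `f` is a bijection from `x` onto `y`. -/
def isBijection {n : ℕ} (f x y : Fin n) : Fml n :=
  isInjection f x y ⊓
    all fun b => mem b (up y) ⟹ ex fun a => pairMem a (up b) (up (up f))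

/-- `|x| ≤ |y|` -/
def cardLE {n : ℕ} (x y : Fin n) : Fml n := ex fun f => isInjection f (up x) (up y)

/-- `|x| = |y|` -/
def cardEq {n : ℕ} (x y : Fin n) : Fml n := ex fun f => isBijection f (up x) (up y)

/-- `x` and `y` are comparable: `|x| ≤ |y|` or `|y| ≤ |x|`. -/
def comparable {n : ℕ} (x y : Fin n) : Fml n := cardLE x y ⊔ cardLE y x

/-- `|x| = ℵ₀` -/
def cardEqAlephZero {n : ℕ} (x : Fin n) : Fml n := ex fun w => isOmega w ⊓ cardEq (up x) w

/-! ### The theory ZF -/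

def extensionality : setLang.Sentence :=
  all (n := 0) fun x => all fun y =>
    (all fun z => mem z (up (up x)) ⇔ mem z (up y)) ⟹ eq (up x) y

def emptySet : setLang.Sentence := ex (n := 0) fun e => isEmpty e

def pairing : setLang.Sentence :=
  all (n := 0) fun a => all fun b => ex fun p => isPair p (up (up a)) (up b)

def union : setLang.Sentence :=
  all (n := 0) fun a => ex fun u => all fun z =>
    mem z (up u) ⇔ ex fun y => mem y (up (up (up a))) ⊓ mem (up z) y

def powerset : setLang.Sentence :=
  all (n := 0) fun a => ex fun p => all fun z => mem z (up p) ⇔ subset z (up (up a))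

def infinity : setLang.Sentence := ex (n := 0) fun w => isInductive w

def foundation : setLang.Sentence :=
  all (n := 0) fun x => ∼(isEmpty x) ⟹
    ex fun y => mem y (up x) ⊓ all fun z => mem z (up (up x)) ⟹ ∼(mem z (up y))

/-- Separation for a formula `φ(p, x)` with `n` parameters `p`:
`∀ p, ∀ a, ∃ b, ∀ x, (x ∈ b ↔ x ∈ a ∧ φ(p, x))`. -/
def separation {n : ℕ} (φ : setLang.Formula (Fin n ⊕ Fin 1)) : setLang.Sentence :=
  BoundedFormula.alls (n := n) <|
    all fun a => ex fun b => all fun x =>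
      mem x (up b) ⇔
        (mem x (up (up a)) ⊓ inst φ (Sum.elim (fun i => up (up (up i))) ![x]))

/-- Replacement for a formula `φ(p, x, y)` with `n` parameters `p`: for all `p` and all `a`, if
`∀ x ∈ a, ∀ y, ∀ z, (φ(p, x, y) ∧ φ(p, x, z) → z = y)` then
`∃ b, ∀ y, (y ∈ b ↔ ∃ x ∈ a, φ(p, x, y))`. -/
def replacement {n : ℕ} (φ : setLang.Formula (Fin n ⊕ Fin 2)) : setLang.Sentence :=
  BoundedFormula.alls (n := n) <|
    all fun a =>
      (all fun x => mem x (up a) ⟹ all fun y => all fun z =>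
        (inst φ (Sum.elim (fun i => up (up (up (up i)))) ![up (up x), up y]) ⊓
          inst φ (Sum.elim (fun i => up (up (up (up i)))) ![up (up x), z])) ⟹ eq z (up y)) ⟹
      ex fun b => all fun y =>
        mem y (up b) ⇔ ex fun x => mem x (up (up (up a))) ⊓
          inst φ (Sum.elim (fun i => up (up (up (up i)))) ![x, up y])

/-- Zermelo–Fraenkel set theory (without Choice). -/
def ZF : setLang.Theory :=
  {extensionality, emptySet, pairing, union, powerset, infinity, foundation} ∪
    {σ | ∃ (n : ℕ) (φ : setLang.Formula (Fin n ⊕ Fin 1)), σ = separation φ} ∪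
    {σ | ∃ (n : ℕ) (φ : setLang.Formula (Fin n ⊕ Fin 2)), σ = replacement φ}

/-! ### The comparability axioms

A formula `φ(x)` in one free variable is a formula with variables in `Fin 1`; its extension is
the class `X_φ = {x : φ(x)}`. -/

/-- "`X_φ` is a proper class", that is, no set `x` equals `X_φ`. -/
def isProperClass (φ : setLang.Formula (Fin 1)) : setLang.Sentence :=
  all (n := 0) fun x => ∼(all fun y => mem y (up x) ⇔ inst φ ![y])

/-- `Comp_φ`: if `X_φ` is a proper class, then it has two distinct comparable elements. -/
def compClass (φ : setLang.Formula (Fin 1)) : setLang.Sentence :=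
  isProperClass φ ⟹
    ex (n := 0) fun y => ex fun z =>
      (inst φ ![up y] ⊓ inst φ ![z]) ⊓ (∼(eq (up y) z) ⊓ comparable (up y) z)

/-- `Comp_ω`: every set of cardinality `ℵ₀` has two distinct comparable elements. -/
def compOmega : setLang.Sentence :=
  all (n := 0) fun x => cardEqAlephZero x ⟹
    ex fun y => ex fun z =>
      (mem (up y) (up (up x)) ⊓ mem z (up (up x))) ⊓ (∼(eq (up y) z) ⊓ comparable (up y) z)

end FirstOrderZF

set_option linter.unusedSectionVars false
set_option linter.unusedSimpArgs false

namespace FirstOrderZF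

universe u

/-! Work in a model of ZF and suppose that a proper class `X` consists of pairwise incomparable
sets. Under Comp_ω, no sequence of pairwise incomparable sets indexed by ω exists, so every subset
of `X` is Dedekind-finite. The contradiction comes from building such a sequence out of `X`.

The `n`-th term is the sum `B n` of a Dedekind-finite set `D n`, which shrinks with `n`, and a set
`T n`, which grows. Here `T (n+1)` is the union of `T n` and `ω × 𝒫(T n)`. With `Tinf` the union of
all `T n`, choose an increasing sequence `W n` such that the part of `X` in `W (n+1)` outside `W n`
does not embed in `𝒫(Tinf)`. Then `D n` is the part of `X` in the union of the `W k` outside `W n`.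

Let `n < m`. If `B n` embedded in `B m`, the points of `D n` outside `D m` would start disjoint
orbits; Dedekind-finiteness forces each orbit to leave `D m` and end in `T m`, so these points embed
in `𝒫(T m)`, against the choice of `W (n+1)` (`cardLE_pow_of_orbits`). If `B m` embedded in `B n`,
then so would `ω × 𝒫(T n)`; no row `ω × {c}` fits into `D n`, so every row meets `T n`, and Cantor's
diagonal argument applies (`not_injective_prod_pow`).

The `W n` exist by `exists_level_not_cardLE`. They are picked without Choice as least levels of the
cumulative hierarchy. Separation and replacement apply only to definable predicates, so definability
with parameters (`Dfn`, `DTerm`) accompanies every construction. -/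

/-- Membership in a structure for the language of set theory. -/
def E {M : Type u} [setLang.Structure M] (x y : M) : Prop :=
  Structure.RelMap (L := setLang) MemSymbol.mem ![x, y]

infix:50 " ∊ " => E

/-! ### Definability with parameters -/

/-- Types of finite nonempty tuples of elements of `M`: these are `M`, `M × M`, `(M × M) × M`, … -/
class Ctx (M : Type u) (Γ : Type u) where
  arity : ℕ
  val : Γ → Fin arity → M

instance (M : Type u) : Ctx M M := ⟨1, fun x _ => x⟩

instance (M Γ : Type u) [c : Ctx M Γ] : Ctx M (Γ × M) :=
  ⟨c.arity + 1, fun p => Fin.snoc (c.val p.1) p.2⟩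

section

variable {M : Type u} [setLang.Structure M]

/-- The assignment of values to parameters and variables. -/
def assign {Γ : Type u} [Ctx M Γ] (g : Γ) : M ⊕ Fin (Ctx.arity M Γ) → M :=
  Sum.elim id (Ctx.val g)

variable (M) in
/-- A predicate on tuples that is definable with parameters. -/
class Dfn {Γ : Type u} [Ctx M Γ] (P : Γ → Prop) : Prop where
  out : ∃ φ : setLang.Formula (M ⊕ Fin (Ctx.arity M Γ)), ∀ g, P g ↔ φ.Realize (assign g)

/-- A function on tuples whose graph is definable with parameters. -/
class DTerm {Γ : Type u} [Ctx M Γ] (t : Γ → M) : Prop where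
  out : Dfn M (fun p : Γ × M => p.2 = t p.1)

variable {Γ Δ : Type u} [Ctx M Γ] [Ctx M Δ]

theorem dfn_congr {P Q : Γ → Prop} (hP : Dfn M P) (h : ∀ g, P g ↔ Q g) : Dfn M Q := by
  obtain ⟨φ, hφ⟩ := hP.out
  exact ⟨φ, fun g => (h g).symm.trans (hφ g)⟩

instance instDfnConst (p : Prop) : Dfn M (fun _ : Γ => p) := by
  by_cases h : p
  · exact ⟨⊤, fun g => by simp [h, Formula.Realize]⟩
  · exact ⟨⊥, fun g => by simp [h, Formula.Realize]⟩

instance instDfnAnd {P Q : Γ → Prop} [hP : Dfn M P] [hQ : Dfn M Q] :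
    Dfn M (fun g => P g ∧ Q g) := by
  obtain ⟨φ, hφ⟩ := hP.out
  obtain ⟨ψ, hψ⟩ := hQ.out
  exact ⟨φ ⊓ ψ, fun g => by rw [Formula.realize_inf, hφ, hψ]⟩

instance instDfnNot {P : Γ → Prop} [hP : Dfn M P] : Dfn M (fun g => ¬ P g) := by
  obtain ⟨φ, hφ⟩ := hP.out
  exact ⟨φ.not, fun g => by rw [Formula.realize_not, hφ]⟩

instance instDfnOr {P Q : Γ → Prop} [Dfn M P] [Dfn M Q] : Dfn M (fun g => P g ∨ Q g) :=
  dfn_congr (P := fun g => ¬ (¬ P g ∧ ¬ Q g)) inferInstance fun g => by tauto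

instance instDfnImp {P Q : Γ → Prop} [Dfn M P] [Dfn M Q] : Dfn M (fun g => P g → Q g) :=
  dfn_congr (P := fun g => ¬ P g ∨ Q g) inferInstance fun g => by tauto

instance instDfnIff {P Q : Γ → Prop} [Dfn M P] [Dfn M Q] : Dfn M (fun g => P g ↔ Q g) :=
  dfn_congr (P := fun g => (P g → Q g) ∧ (Q g → P g)) inferInstance fun g => by tauto

theorem assign_snoc (g : Γ) (x : M) (i : M ⊕ Fin (Ctx.arity M Γ)) :
    assign (Γ := Γ × M) (g, x) (Sum.map id Fin.castSucc i) = assign g i := by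
  rcases i with i | i
  · rfl
  · exact Fin.snoc_castSucc (α := fun _ => M) x (Ctx.val g) i

theorem assign_last (g : Γ) (x : M) :
    assign (Γ := Γ × M) (g, x) (Sum.inr (Fin.last (Ctx.arity M Γ))) = x :=
  Fin.snoc_last (α := fun _ => M) x (Ctx.val g)

/-- The last coordinate of the tuple becomes the bound variable; the parameters and the other
coordinates stay free. -/
instance instDfnEx {P : Γ → M → Prop} [hP : Dfn M (fun p : Γ × M => P p.1 p.2)] :
    Dfn M (fun g => ∃ x, P g x) := by
  obtain ⟨φ, hφ⟩ := hP.out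
  refine ⟨(BoundedFormula.relabel (n := 1) (k := 0)
    (Sum.elim (fun m => Sum.inl (Sum.inl m))
      (Fin.lastCases (Sum.inr 0) fun i => Sum.inl (Sum.inr i)) :
      M ⊕ Fin (Ctx.arity M Γ + 1) → (M ⊕ Fin (Ctx.arity M Γ)) ⊕ Fin 1) φ).ex, fun g => ?_⟩
  rw [Formula.Realize, BoundedFormula.realize_ex]
  refine exists_congr fun x => ?_
  rw [BoundedFormula.realize_relabel, hφ (g, x), Formula.Realize]
  have : (assign (Γ := Γ × M) (g, x)) = (Sum.elim (assign g) ((Fin.snoc default x :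
      Fin 1 → M) ∘ Fin.castAdd 0) ∘ (Sum.elim (fun m => Sum.inl (Sum.inl m))
      (Fin.lastCases (Sum.inr 0) fun i => Sum.inl (Sum.inr i)) :
      M ⊕ Fin (Ctx.arity M Γ + 1) → (M ⊕ Fin (Ctx.arity M Γ)) ⊕ Fin 1)) := by
    funext i
    rcases i with i | i
    · rfl
    · induction i using Fin.lastCases with
      | last => simpa [Fin.snoc] using assign_last g x
      | cast i => simpa using assign_snoc g x (Sum.inr i)
  rw [← this]
  exact iff_of_eq (congrArg _ (Subsingleton.elim _ _))

instance instDfnAll {P : Γ → M → Prop} [Dfn M (fun p : Γ × M => P p.1 p.2)] :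
    Dfn M (fun g => ∀ x, P g x) :=
  dfn_congr (P := fun g => ¬ ∃ x, ¬ P g x) inferInstance fun g => by simp

/-- A function on tuples that is a coordinate or a constant. -/
def IsVar (t : Γ → M) : Prop := ∃ i : M ⊕ Fin (Ctx.arity M Γ), ∀ g, t g = assign g i

/-- A substitution of coordinates and constants for coordinates. -/
def IsSubst (c : Δ → Γ) : Prop := ∀ i, IsVar (fun d => Ctx.val (M := M) (c d) i)

theorem isVar_snd : IsVar (fun p : Γ × M => p.2) :=
  ⟨Sum.inr (Fin.last _), fun p => (assign_last p.1 p.2).symm⟩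

theorem isVar_id : IsVar (fun x : M => x) := ⟨Sum.inr (0 : Fin 1), fun _ => rfl⟩

theorem IsVar.fst {t : Γ → M} (h : IsVar t) : IsVar (fun p : Γ × M => t p.1) := by
  obtain ⟨i, hi⟩ := h
  exact ⟨_, fun p => (hi p.1).trans (assign_snoc p.1 p.2 i).symm⟩

theorem isSubst_id : IsSubst (M := M) (fun g : Γ => g) := fun i => ⟨Sum.inr i, fun _ => rfl⟩

theorem IsSubst.fst {c : Δ → Γ} (h : IsSubst (M := M) c) :
    IsSubst (M := M) (fun p : Δ × M => c p.1) := fun i => (h i).fst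

theorem IsVar.isSubst {t : Δ → M} (h : IsVar t) : IsSubst (M := M) t := fun _ => h

theorem IsSubst.pair {c : Δ → Γ} (h : IsSubst (M := M) c) {t : Δ → M} (ht : IsVar t) :
    IsSubst (M := M) (fun d => (c d, t d)) := by
  refine Fin.lastCases ?_ fun i => ?_
  · obtain ⟨j, hj⟩ := ht
    exact ⟨j, fun d => (assign_last (c d) (t d)).trans (hj d)⟩
  · obtain ⟨j, hj⟩ := h i
    exact ⟨j, fun d => (assign_snoc (c d) (t d) (Sum.inr i)).trans (hj d)⟩

/-- Pulling back along a change of coordinates amounts to relabelling the free variables of the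
defining formula. -/
theorem dfn_subst {c : Δ → Γ} (hc : IsSubst (M := M) c) {P : Γ → Prop} (hP : Dfn M P) :
    Dfn M (fun d => P (c d)) := by
  obtain ⟨φ, hφ⟩ := hP.out
  choose r hr using hc
  refine ⟨φ.relabel (Sum.elim Sum.inl r), fun d => ?_⟩
  rw [Formula.realize_relabel, hφ]
  refine iff_of_eq (congrArg _ ?_)
  funext i
  rcases i with i | i
  · rfl
  · exact hr i d

theorem dfn_fst {P : Γ → Prop} (hP : Dfn M P) : Dfn M (fun p : Γ × M => P p.1) :=
  dfn_subst isSubst_id.fst hP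

theorem dfn_skip {P : Γ × M → Prop} (hP : Dfn M P) :
    Dfn M (fun p : (Γ × M) × M => P (p.1.1, p.2)) :=
  dfn_subst (isSubst_id.fst.fst.pair isVar_snd) hP

theorem IsVar.dterm {t : Γ → M} (h : IsVar t) : DTerm t := by
  obtain ⟨i, h⟩ := h
  refine ⟨⟨Term.equal (L := setLang) (.var (Sum.inr (Fin.last _)))
    (.var (Sum.map id Fin.castSucc i)), fun p => ?_⟩⟩
  rw [Formula.realize_equal, Term.realize_var, Term.realize_var]
  rw [show p = (p.1, p.2) from rfl, assign_last, assign_snoc, h]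

instance instDTermConst (m : M) : DTerm (fun _ : Γ => m) :=
  IsVar.dterm ⟨Sum.inl m, fun _ => rfl⟩

instance instDTermId : DTerm (fun x : M => x) := isVar_id.dterm

instance instDTermFst {t : Γ → M} [ht : DTerm t] : DTerm (fun p : Γ × M => t p.1) :=
  ⟨dfn_skip (P := fun q : Γ × M => q.2 = t q.1) ht.out⟩

instance instDTermFst₂ {t : Γ → M} [DTerm t] : DTerm (fun p : (Γ × M) × M => t p.1.1) :=
  instDTermFst (t := fun p : Γ × M => t p.1)

instance instDTermFst₃ {t : Γ → M} [DTerm t] :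
    DTerm (fun p : ((Γ × M) × M) × M => t p.1.1.1) :=
  instDTermFst (t := fun p : (Γ × M) × M => t p.1.1)

instance instDTermSnd : DTerm (fun p : Γ × M => p.2) := isVar_snd.dterm

instance instDTermSnd₁ : DTerm (fun p : (Γ × M) × M => p.1.2) := isVar_snd.fst.dterm

instance instDTermSnd₂ : DTerm (fun p : ((Γ × M) × M) × M => p.1.1.2) :=
  isVar_snd.fst.fst.dterm

instance instDTermSnd₃ : DTerm (fun p : (((Γ × M) × M) × M) × M => p.1.1.1.2) :=
  isVar_snd.fst.fst.fst.dterm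

instance instDTermSnd₄ : DTerm (fun p : ((((Γ × M) × M) × M) × M) × M => p.1.1.1.1.2) :=
  isVar_snd.fst.fst.fst.fst.dterm

instance instDTermBot₁ : DTerm (fun p : M × M => p.1) := isVar_id.fst.dterm

instance instDTermBot₂ : DTerm (fun p : (M × M) × M => p.1.1) := isVar_id.fst.fst.dterm

instance instDTermBot₃ : DTerm (fun p : ((M × M) × M) × M => p.1.1.1) :=
  isVar_id.fst.fst.fst.dterm

instance instDTermBot₄ : DTerm (fun p : (((M × M) × M) × M) × M => p.1.1.1.1) :=
  isVar_id.fst.fst.fst.fst.dterm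

/-- Substitution of a definable term in a definable predicate. -/
theorem dfn_comp {R : Γ → M → Prop} (hR : Dfn M (fun p : Γ × M => R p.1 p.2)) {t : Γ → M}
    (ht : DTerm t) : Dfn M (fun g => R g (t g)) := by
  have := ht.out
  exact dfn_congr (P := fun g => ∃ x, x = t g ∧ R g x) inferInstance fun g => by simp

instance instDfnMem {t s : Γ → M} [ht : DTerm t] [hs : DTerm s] :
    Dfn M (fun g => t g ∊ s g) := by
  have h2 : Dfn M (fun p : (Γ × M) × M => p.1.2 ∊ p.2) := by
    refine ⟨Relations.formula₂ (L := setLang) (MemSymbol.mem : setLang.Relations 2)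
      (.var (Sum.inr (Fin.castSucc (Fin.last _)))) (.var (Sum.inr (Fin.last _))), fun p => ?_⟩
    refine Iff.trans ?_ Formula.realize_rel₂.symm
    refine iff_of_eq (congrArg₂ (fun x y : M => x ∊ y) ?_ ?_)
    · exact (assign_last p.1.1 p.1.2).symm.trans
        (assign_snoc p.1 p.2 (Sum.inr (Fin.last _))).symm
    · exact (assign_last p.1 p.2).symm
  have h1 : Dfn M (fun p : Γ × M => p.2 ∊ s p.1) :=
    dfn_comp (R := fun (p : Γ × M) y => p.2 ∊ y) h2 inferInstance
  exact dfn_comp (R := fun g x => x ∊ s g) h1 ht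

instance instDfnEq {t s : Γ → M} [ht : DTerm t] [hs : DTerm s] : Dfn M (fun g => t g = s g) :=
  dfn_comp (R := fun g x => x = s g) hs.out ht

instance instDfnMemEta (x : M) : Dfn M (E x) := instDfnMem (t := fun _ => x) (s := fun y => y)

instance instDfnEqEta (x : M) : Dfn M (Eq x) := instDfnEq (t := fun _ => x) (s := fun y => y)

theorem dfn_unary {P : M → Prop} (hP : Dfn M P) {t : Γ → M} (ht : DTerm t) :
    Dfn M (fun g => P (t g)) :=
  dfn_comp (R := fun _ x => P x) (dfn_subst isVar_snd.isSubst hP) ht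

theorem dfn_binary {P : M → M → Prop} (hP : Dfn M (fun p : M × M => P p.1 p.2)) {t s : Γ → M}
    (ht : DTerm t) (hs : DTerm s) : Dfn M (fun g => P (t g) (s g)) := by
  refine dfn_comp (R := fun g y => P (t g) y) ?_ hs
  refine dfn_comp (R := fun (p : Γ × M) x => P x p.2) ?_ inferInstance
  exact dfn_subst (isVar_snd.isSubst.pair isVar_snd.fst) hP

theorem dterm_unary {G : M → M} (hG : DTerm G) {t : Γ → M} (ht : DTerm t) :
    DTerm (fun g => G (t g)) :=
  ⟨dfn_binary (P := fun x y => y = G x) hG.out (t := fun p : Γ × M => t p.1) inferInstance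
    inferInstance⟩

/-! ### Definite descriptions -/

variable [Nonempty M]

open Classical in
/-- The unique object with the property `Q`, with a default value if there is none. -/
noncomputable def iota (Q : M → Prop) : M :=
  if h : ∃ y, ∀ z, Q z ↔ z = y then h.choose else Classical.arbitrary M

theorem iota_spec {Q : M → Prop} {y : M} (h : ∀ z, Q z ↔ z = y) : iota Q = y := by
  have h' : ∃ y, ∀ z, Q z ↔ z = y := ⟨y, h⟩
  rw [iota, dif_pos h']
  exact (h _).1 ((h'.choose_spec _).2 rfl)

instance instDTermIota {Q : Γ → M → Prop} [hQ : Dfn M (fun p : Γ × M => Q p.1 p.2)] :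
    DTerm (fun g => iota (Q g)) := by
  have h1 : Dfn M (fun p : (Γ × M) × M => Q p.1.1 p.2) :=
    dfn_skip (P := fun q : Γ × M => Q q.1 q.2) hQ
  have h2 : Dfn M (fun g => ∃ y, ∀ z, Q g z ↔ z = y) := inferInstance
  have h3 := dfn_fst h2
  -- Unique existence is itself definable, and the default value is a parameter, so the graph is
  -- defined by cases.
  refine ⟨dfn_congr (P := fun p : Γ × M => ((∃ y, ∀ z, Q p.1 z ↔ z = y) ∧ Q p.1 p.2) ∨
    (¬ (∃ y, ∀ z, Q p.1 z ↔ z = y) ∧ p.2 = Classical.arbitrary M)) inferInstance fun p => ?_⟩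
  by_cases h : ∃ y, ∀ z, Q p.1 z ↔ z = y
  · obtain ⟨y, hy⟩ := id h
    rw [iota_spec hy, ← hy]
    tauto
  · simp [h, iota]

/-- The set of all objects with the property `Q`, with a default value if there is none. -/
noncomputable def cls (Q : M → Prop) : M := iota fun s => ∀ z, z ∊ s ↔ Q z

instance instDTermCls {Q : Γ → M → Prop} [hQ : Dfn M (fun p : Γ × M => Q p.1 p.2)] :
    DTerm (fun g => cls (Q g)) := by
  have h1 : Dfn M (fun p : (Γ × M) × M => Q p.1.1 p.2) :=
    dfn_skip (P := fun q : Γ × M => Q q.1 q.2) hQ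
  unfold cls
  infer_instance

end

/-! ### The set-theoretic predicates in a structure -/

section

variable {M : Type u} [setLang.Structure M]

def Sub (x y : M) : Prop := ∀ z, z ∊ x → z ∊ y
def IsPair (p a b : M) : Prop := ∀ z, z ∊ p ↔ z = a ∨ z = b
def IsOrdPair (p a b : M) : Prop := ∃ s, IsPair s a a ∧ ∃ t, IsPair t a b ∧ IsPair p s t
def IsSucc (s x : M) : Prop := ∀ z, z ∊ s ↔ z ∊ x ∨ z = x
def IsInductive (w : M) : Prop :=
  (∃ e : M, (∀ z, ¬ z ∊ e) ∧ e ∊ w) ∧ ∀ x, x ∊ w → ∃ s, IsSucc s x ∧ s ∊ w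
def PairMem (a b f : M) : Prop := ∃ p, IsOrdPair p a b ∧ p ∊ f
def IsFunction (f x y : M) : Prop :=
  (∀ p, p ∊ f → ∃ a, a ∊ x ∧ ∃ b, b ∊ y ∧ IsOrdPair p a b) ∧
    ∀ a, a ∊ x → ∃ b, PairMem a b f ∧ ∀ c, PairMem a c f → c = b
def IsInjection (f x y : M) : Prop :=
  IsFunction f x y ∧ ∀ a b c, PairMem a c f ∧ PairMem b c f → a = b
def IsBijection (f x y : M) : Prop :=
  IsInjection f x y ∧ ∀ b, b ∊ y → ∃ a, PairMem a b f
def CardLE (x y : M) : Prop := ∃ f, IsInjection f x y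

variable {n : ℕ} {v : Empty → M} {xs : Fin n → M}

/-! ### Satisfaction of the set-theoretic formulas -/

theorem realize_all {body : Fin (n + 1) → Fml (n + 1)} :
    (all body).Realize v xs ↔ ∀ a, (body (Fin.last n)).Realize v (Fin.snoc xs a) :=
  BoundedFormula.realize_all

theorem realize_ex {body : Fin (n + 1) → Fml (n + 1)} :
    (ex body).Realize v xs ↔ ∃ a, (body (Fin.last n)).Realize v (Fin.snoc xs a) :=
  BoundedFormula.realize_ex

theorem realize_mem {x y : Fin n} : (mem x y).Realize v xs ↔ xs x ∊ xs y :=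
  BoundedFormula.realize_rel₂

theorem realize_eq {x y : Fin n} : (eq x y).Realize v xs ↔ xs x = xs y :=
  BoundedFormula.realize_bdEqual _ _

theorem realize_inst {α : Type} {φ : setLang.Formula α} {g : α → Fin n} :
    (inst φ g).Realize v xs ↔ φ.Realize (fun a => xs (g a)) := by
  rw [inst]
  erw [BoundedFormula.realize_relabel]
  exact iff_of_eq (congrArg₂ _ rfl (Subsingleton.elim _ _))

theorem snoc_up (a : M) (x : Fin n) : (Fin.snoc xs a : Fin (n + 1) → M) (up x) = xs x :=
  Fin.snoc_castSucc (α := fun _ => M) a xs x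

theorem snoc_last (a : M) : (Fin.snoc xs a : Fin (n + 1) → M) (Fin.last n) = a :=
  Fin.snoc_last (α := fun _ => M) a xs

theorem realize_subset {x y : Fin n} : (subset x y).Realize v xs ↔ Sub (xs x) (xs y) := by
  simp only [subset, Sub, realize_all, realize_mem, BoundedFormula.realize_imp, snoc_up,
    snoc_last]

theorem realize_isEmpty {x : Fin n} : (isEmpty x).Realize v xs ↔ ∀ z, ¬ z ∊ xs x := by
  simp only [isEmpty, realize_all, realize_mem, BoundedFormula.realize_not, snoc_up, snoc_last]

theorem realize_isPair {p a b : Fin n} :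
    (isPair p a b).Realize v xs ↔ IsPair (xs p) (xs a) (xs b) := by
  simp only [isPair, IsPair, realize_all, realize_mem, realize_eq, BoundedFormula.realize_iff,
    BoundedFormula.realize_sup, snoc_up, snoc_last]

theorem realize_isOrdPair {p a b : Fin n} :
    (isOrdPair p a b).Realize v xs ↔ IsOrdPair (xs p) (xs a) (xs b) := by
  simp only [isOrdPair, IsOrdPair, realize_ex, realize_isPair, BoundedFormula.realize_inf, snoc_up,
    snoc_last]

theorem realize_isInductive {w : Fin n} :
    (isInductive w).Realize v xs ↔ IsInductive (xs w) := by
  simp only [isInductive, IsInductive, isSucc, IsSucc, realize_all, realize_ex, realize_mem,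
    realize_eq, realize_isEmpty, BoundedFormula.realize_iff, BoundedFormula.realize_imp,
    BoundedFormula.realize_inf, BoundedFormula.realize_sup, snoc_up, snoc_last]

theorem realize_isOmega {w : Fin n} : (isOmega w).Realize v xs ↔
    IsInductive (xs w) ∧ ∀ u, IsInductive u → Sub (xs w) u := by
  simp only [isOmega, realize_all, realize_subset, realize_isInductive, BoundedFormula.realize_imp,
    BoundedFormula.realize_inf, snoc_up, snoc_last]

theorem realize_pairMem {a b f : Fin n} :
    (pairMem a b f).Realize v xs ↔ PairMem (xs a) (xs b) (xs f) := by
  simp only [pairMem, PairMem, realize_ex, realize_mem, realize_isOrdPair,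
    BoundedFormula.realize_inf, snoc_up, snoc_last]

theorem realize_isInjection {f x y : Fin n} :
    (isInjection f x y).Realize v xs ↔ IsInjection (xs f) (xs x) (xs y) := by
  simp only [isInjection, isFunction, isRelation, IsInjection, IsFunction, realize_all, realize_ex,
    realize_mem, realize_eq, realize_isOrdPair, realize_pairMem, BoundedFormula.realize_imp,
    BoundedFormula.realize_inf, snoc_up, snoc_last]

theorem realize_comparable {x y : Fin n} :
    (comparable x y).Realize v xs ↔ CardLE (xs x) (xs y) ∨ CardLE (xs y) (xs x) := by
  simp only [comparable, cardLE, CardLE, realize_ex, realize_isInjection,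
    BoundedFormula.realize_sup, snoc_up, snoc_last]

theorem realize_cardEqAlephZero {x : Fin n} : (cardEqAlephZero x).Realize v xs ↔
    ∃ w, (IsInductive w ∧ ∀ u, IsInductive u → Sub w u) ∧ ∃ f, IsBijection f (xs x) w := by
  simp only [cardEqAlephZero, cardEq, isBijection, IsBijection, realize_ex, realize_all,
    realize_mem, realize_pairMem, realize_isInjection, realize_isOmega, BoundedFormula.realize_imp,
    BoundedFormula.realize_inf, snoc_up, snoc_last]

/-- A formula with parameters in `M`, written with finitely many parameter variables. -/
theorem exists_finite_parameters {α : Type} (m₀ : M) (ψ : setLang.Formula (M ⊕ α)) :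
    ∃ (k : ℕ) (φ : setLang.Formula (Fin k ⊕ α)) (p : Fin k → M), ∀ xs : α → M,
      φ.Realize (Sum.elim p xs) ↔ ψ.Realize (Sum.elim id xs) := by
  classical
  let S := BoundedFormula.freeVarFinset ψ
  let f : S → Fin S.card ⊕ α := fun s =>
    Sum.elim (fun _ => Sum.inl (S.equivFin s)) Sum.inr s.1
  refine ⟨S.card, BoundedFormula.restrictFreeVar ψ f,
    fun j => Sum.elim id (fun _ => m₀) (S.equivFin.symm j).1, fun xs => ?_⟩
  refine BoundedFormula.realize_restrictFreeVar (Sum.elim id xs) ?_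
  rintro ⟨m | a, h⟩
  · simp [f]
  · simp [f]

/-- The axioms of `ZF`, with definable predicates in the place of formulas. -/
class ZFModel (M : Type u) [setLang.Structure M] : Prop where
  nonempty : Nonempty M
  ext : ∀ x y : M, (∀ z, z ∊ x ↔ z ∊ y) → x = y
  exists_pair : ∀ a b : M, ∃ p, ∀ z, z ∊ p ↔ z = a ∨ z = b
  exists_sUnion : ∀ a : M, ∃ u, ∀ z, z ∊ u ↔ ∃ y, y ∊ a ∧ z ∊ y
  exists_pow : ∀ a : M, ∃ p, ∀ z, z ∊ p ↔ Sub z a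
  exists_inductive : ∃ w : M, IsInductive w
  foundation : ∀ x : M, (∃ y, y ∊ x) → ∃ y, y ∊ x ∧ ∀ z, z ∊ x → ¬ z ∊ y
  exists_sep : ∀ (P : M → Prop) [Dfn M P] (a : M), ∃ b, ∀ x, x ∊ b ↔ x ∊ a ∧ P x
  exists_repl : ∀ (R : M → M → Prop) [Dfn M (fun p : M × M => R p.1 p.2)] (a : M),
    (∀ x, x ∊ a → ∀ y z, R x y → R x z → z = y) → ∃ b, ∀ y, y ∊ b ↔ ∃ x, x ∊ a ∧ R x y

/-- The schemes concern formulas with finitely many parameters, while `Dfn` allows any element of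
`M` as a parameter; since a formula mentions only finitely many of them, `exists_finite_parameters`
closes the gap. -/
theorem zfModel_of_models [Nonempty M] (h : M ⊨ ZF) : ZFModel M := by
  have ax : ∀ σ ∈ ZF, M ⊨ σ := fun σ hσ => (Theory.model_iff _).1 h σ hσ
  have ax' : ∀ σ ∈ ({extensionality, emptySet, pairing, union, powerset, infinity,
      foundation} : setLang.Theory), BoundedFormula.Realize (M := M) σ default default :=
    fun σ hσ => ax σ (Or.inl (Or.inl hσ))
  refine ⟨inferInstance, ?_, ?_, ?_, ?_, ?_, ?_, ?_, ?_⟩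
  · have := ax' extensionality (by simp)
    simpa only [extensionality, realize_all, realize_mem, realize_eq, BoundedFormula.realize_iff,
      BoundedFormula.realize_imp, snoc_up, snoc_last] using this
  · have := ax' pairing (by simp)
    simpa only [pairing, realize_all, realize_ex, realize_isPair, IsPair, snoc_up, snoc_last]
      using this
  · have := ax' union (by simp)
    simpa only [union, realize_all, realize_ex, realize_mem, BoundedFormula.realize_iff,
      BoundedFormula.realize_inf, snoc_up, snoc_last] using this
  · have := ax' powerset (by simp)
    simpa only [powerset, realize_all, realize_ex, realize_mem, realize_subset,
      BoundedFormula.realize_iff, snoc_up, snoc_last] using this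
  · have := ax' infinity (by simp)
    simpa only [infinity, realize_ex, realize_isInductive, snoc_last] using this
  · have := ax' foundation (by simp)
    simpa only [foundation, realize_all, realize_ex, realize_mem, realize_isEmpty,
      BoundedFormula.realize_imp, BoundedFormula.realize_not, BoundedFormula.realize_inf, snoc_up,
      snoc_last, not_forall, not_not] using this
  · intro P hP a
    obtain ⟨ψ, hψ⟩ := hP.out
    obtain ⟨k, φ, p, hφ⟩ := exists_finite_parameters a ψ
    have := ax (separation φ) (Or.inl (Or.inr ⟨k, φ, rfl⟩))
    have := BoundedFormula.realize_alls.1 this p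
    simp only [realize_all, realize_ex, realize_mem, realize_inst, BoundedFormula.realize_iff,
      BoundedFormula.realize_inf, snoc_up, snoc_last] at this
    obtain ⟨b, hb⟩ := this a
    refine ⟨b, fun x => (hb x).trans (and_congr_right fun _ => ?_)⟩
    rw [hψ x]
    refine Iff.trans (iff_of_eq (congrArg _ ?_)) (hφ _)
    funext i
    rcases i with i | i
    · simp only [Sum.elim_inl, snoc_up]
    · rw [Subsingleton.elim i 0]
      exact snoc_last x
  · intro R hR a hfun
    obtain ⟨ψ, hψ⟩ := hR.out
    obtain ⟨k, φ, p, hφ⟩ := exists_finite_parameters a ψ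
    have := ax (replacement φ) (Or.inr ⟨k, φ, rfl⟩)
    have := BoundedFormula.realize_alls.1 this p
    simp only [realize_all, realize_ex, realize_mem, realize_eq, realize_inst,
      BoundedFormula.realize_iff, BoundedFormula.realize_imp, BoundedFormula.realize_inf, snoc_up,
      snoc_last] at this
    have key : ∀ (x y : M) (w : Fin k ⊕ Fin 2 → M), (∀ i, w (Sum.inl i) = p i) →
        w (Sum.inr 0) = x → w (Sum.inr 1) = y → (φ.Realize w ↔ R x y) := by
      intro x y w h1 h2 h3
      rw [hψ (x, y)]
      refine Iff.trans (iff_of_eq (congrArg _ ?_)) (hφ _)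
      funext i
      rcases i with i | i
      · exact h1 i
      · refine Fin.cases ?_ (fun j => ?_) i
        · exact h2
        · rw [Subsingleton.elim j 0]
          exact h3
    obtain ⟨b, hb⟩ := this a (fun x hx y z h => hfun x hx y z
      ((key x y _ (fun i => by simp only [Sum.elim_inl, snoc_up])
        (by simp [snoc_up, snoc_last]) (by simp [snoc_up, snoc_last])).1 h.1)
      ((key x z _ (fun i => by simp only [Sum.elim_inl, snoc_up])
        (by simp [snoc_up, snoc_last]) (by simp [snoc_up, snoc_last])).1 h.2))
    refine ⟨b, fun y => (hb y).trans (exists_congr fun x => and_congr_right fun _ => ?_)⟩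
    exact key x y _ (fun i => by simp only [Sum.elim_inl, snoc_up])
      (by simp [snoc_up, snoc_last]) (by simp [snoc_up, snoc_last])

theorem dfn_formula (φ : setLang.Formula (Fin 1)) : Dfn M (fun x : M => φ.Realize ![x]) := by
  refine ⟨φ.relabel Sum.inr, fun x => ?_⟩
  rw [Formula.realize_relabel]
  refine iff_of_eq (congrArg _ ?_)
  funext i
  rw [Subsingleton.elim i 0]
  rfl

end

/-! ### Set operations -/

section

variable {M : Type u} [setLang.Structure M] [ZFModel M]

instance instNonemptyZF : Nonempty M := ZFModel.nonempty

theorem mem_cls {Q : M → Prop} (h : ∃ s : M, ∀ z, z ∊ s ↔ Q z) {z : M} : z ∊ cls Q ↔ Q z := by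
  obtain ⟨s, hs⟩ := h
  have : cls Q = s := iota_spec fun t =>
    ⟨fun ht => ZFModel.ext _ _ fun z => (ht z).trans (hs z).symm, fun ht => ht ▸ hs⟩
  rw [this, hs]

theorem Sub.antisymm {x y : M} (h₁ : Sub x y) (h₂ : Sub y x) : x = y :=
  ZFModel.ext _ _ fun z => ⟨h₁ z, h₂ z⟩

noncomputable def emp : M := cls fun _ => False
noncomputable def pr (a b : M) : M := cls fun z => z = a ∨ z = b
noncomputable def op (a b : M) : M := pr (pr a a) (pr a b)
noncomputable def sUn (a : M) : M := cls fun z => ∃ y, y ∊ a ∧ z ∊ y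
noncomputable def un (a b : M) : M := sUn (pr a b)
noncomputable def pow (a : M) : M := cls fun z => Sub z a
noncomputable def sep (a : M) (P : M → Prop) : M := cls fun z => z ∊ a ∧ P z
noncomputable def img (F : M → M) (a : M) : M := cls fun z => ∃ x, x ∊ a ∧ z = F x
noncomputable def suc (x : M) : M := un x (pr x x)
noncomputable def om : M := cls fun z => ∀ v, IsInductive v → z ∊ v
noncomputable def prod (a b : M) : M := cls fun z => ∃ x, x ∊ a ∧ ∃ y, y ∊ b ∧ z = op x y
noncomputable def app (f x : M) : M := iota fun y => op x y ∊ f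

section

variable {Γ : Type u} [Ctx M Γ] {t s r : Γ → M} [DTerm t] [DTerm s] [DTerm r]

instance instDfnSub : Dfn M (fun g => Sub (t g) (s g)) := by
  unfold Sub; infer_instance

instance instDTermPr : DTerm (fun g => pr (t g) (s g)) := by
  unfold pr; infer_instance

instance instDTermOp : DTerm (fun g => op (t g) (s g)) := by
  unfold op; infer_instance

instance instDTermSUn : DTerm (fun g => sUn (t g)) := by
  unfold sUn; infer_instance

instance instDTermUn : DTerm (fun g => un (t g) (s g)) := by
  unfold un; infer_instance

instance instDTermPow : DTerm (fun g => pow (t g)) := by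
  unfold pow; infer_instance

instance instDTermSep {P : Γ → M → Prop} [Dfn M (fun p : Γ × M => P p.1 p.2)] :
    DTerm (fun g => sep (t g) (P g)) := by
  unfold sep; infer_instance

instance instDTermImg {F : Γ → M → M} [h : DTerm (fun p : Γ × M => F p.1 p.2)] :
    DTerm (fun g => img (F g) (t g)) := by
  have : DTerm (fun p : (Γ × M) × M => F p.1.1 p.2) :=
    ⟨dfn_subst ((isSubst_id.fst.fst.fst.pair isVar_snd.fst).pair isVar_snd) h.out⟩
  unfold img; infer_instance

instance instDTermSuc : DTerm (fun g => suc (t g)) := by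
  unfold suc; infer_instance

instance instDTermProd : DTerm (fun g => prod (t g) (s g)) := by
  unfold prod; infer_instance

instance instDTermApp : DTerm (fun g => app (t g) (s g)) := by
  unfold app; infer_instance

instance instDTermPrEta (x : M) : DTerm (pr x) :=
  instDTermPr (t := fun _ => x) (s := fun y => y)

instance instDTermOpEta (x : M) : DTerm (op x) :=
  instDTermOp (t := fun _ => x) (s := fun y => y)

instance instDTermAppEta (x : M) : DTerm (app x) :=
  instDTermApp (t := fun _ => x) (s := fun y => y)

instance instDTermSUnEta : DTerm (sUn : M → M) :=
  instDTermSUn (t := fun y => y)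

instance instDTermPowEta : DTerm (pow : M → M) :=
  instDTermPow (t := fun y => y)

instance instDfnIsOrdPair : Dfn M (fun g => IsOrdPair (t g) (s g) (r g)) := by
  unfold IsOrdPair IsPair; infer_instance

instance instDfnPairMem : Dfn M (fun g => PairMem (t g) (s g) (r g)) := by
  unfold PairMem; infer_instance

instance instDfnIsInjection : Dfn M (fun g => IsInjection (t g) (s g) (r g)) := by
  unfold IsInjection IsFunction; infer_instance

instance instDfnCardLE : Dfn M (fun g => CardLE (t g) (s g)) := by
  unfold CardLE; infer_instance

end

theorem mem_pr {a b z : M} : z ∊ pr a b ↔ z = a ∨ z = b := mem_cls (ZFModel.exists_pair a b)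

theorem mem_sUn {a z : M} : z ∊ sUn a ↔ ∃ y, y ∊ a ∧ z ∊ y := mem_cls (ZFModel.exists_sUnion a)

theorem mem_un {a b z : M} : z ∊ un a b ↔ z ∊ a ∨ z ∊ b := by
  simp [un, mem_sUn, mem_pr, or_and_right, exists_or]

theorem mem_pow {a z : M} : z ∊ pow a ↔ Sub z a := mem_cls (ZFModel.exists_pow a)

theorem mem_sep {a z : M} {P : M → Prop} [Dfn M P] : z ∊ sep a P ↔ z ∊ a ∧ P z :=
  mem_cls (ZFModel.exists_sep P a)

theorem mem_img {a z : M} {F : M → M} [h : DTerm F] : z ∊ img F a ↔ ∃ x, x ∊ a ∧ z = F x := by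
  refine mem_cls (@ZFModel.exists_repl M _ _ (fun x y => y = F x) h.out a ?_)
  rintro x - y z rfl rfl
  rfl

theorem not_mem_emp {z : M} : ¬ z ∊ (emp : M) := by
  refine fun h => (mem_cls ?_).1 h
  -- The description `emp` denotes some element in any case; separating from that element yields an
  -- empty set, hence shows that the description is proper.
  obtain ⟨b, hb⟩ := ZFModel.exists_sep (fun _ : M => False) (emp : M)
  exact ⟨b, fun z => (hb z).trans (by simp)⟩

theorem mem_suc {x z : M} : z ∊ suc x ↔ z ∊ x ∨ z = x := by
  simp [suc, mem_un, mem_pr]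

theorem mem_prod {a b z : M} : z ∊ prod a b ↔ ∃ x, x ∊ a ∧ ∃ y, y ∊ b ∧ z = op x y := by
  refine mem_cls ⟨sUn (img (fun x => img (fun y => op x y) b) a), fun z => ?_⟩
  rw [mem_sUn]
  constructor
  · rintro ⟨c, hc, hz⟩
    obtain ⟨x, hx, rfl⟩ := mem_img.1 hc
    exact ⟨x, hx, mem_img.1 hz⟩
  · rintro ⟨x, hx, h⟩
    exact ⟨_, mem_img.2 ⟨x, hx, rfl⟩, mem_img.2 h⟩

theorem pr_self_inj {a b c : M} (h : pr a a = pr b c) : a = b ∧ a = c := by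
  have h1 : b ∊ pr a a := h ▸ mem_pr.2 (Or.inl rfl)
  have h2 : c ∊ pr a a := h ▸ mem_pr.2 (Or.inr rfl)
  rw [mem_pr, or_self] at h1 h2
  exact ⟨h1.symm, h2.symm⟩

theorem pr_inj {a b c : M} (h : pr a b = pr a c) : b = c := by
  have h1 : b ∊ pr a c := h ▸ mem_pr.2 (Or.inr rfl)
  have h2 : c ∊ pr a b := h ▸ mem_pr.2 (Or.inr rfl)
  rw [mem_pr] at h1 h2
  grind

theorem op_inj {a b c d : M} : op a b = op c d ↔ a = c ∧ b = d := by
  refine ⟨fun h => ?_, fun h => by rw [h.1, h.2]⟩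
  have h1 : pr a a ∊ op c d := h ▸ mem_pr.2 (Or.inl rfl)
  have hac : a = c := by
    rcases mem_pr.1 h1 with h1 | h1
    · exact (pr_self_inj h1).1
    · exact (pr_self_inj h1).1
  subst hac
  exact ⟨rfl, pr_inj (pr_inj h)⟩

theorem eq_pr_iff {p a b : M} : IsPair p a b ↔ p = pr a b :=
  ⟨fun h => ZFModel.ext _ _ fun z => (h z).trans mem_pr.symm, fun h _ => h ▸ mem_pr⟩

theorem eq_op_iff {p a b : M} : IsOrdPair p a b ↔ p = op a b := by
  simp [IsOrdPair, eq_pr_iff, op]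

theorem pairMem_iff {a b f : M} : PairMem a b f ↔ op a b ∊ f := by
  simp [PairMem, eq_op_iff]

/-! ### Functions and comparison of cardinalities -/

theorem app_eq {f x y : M} (h : ∀ z, op x z ∊ f ↔ z = y) : app f x = y := iota_spec h

theorem IsFunction.op_mem_iff {f x y a b : M} (h : IsFunction f x y) (ha : a ∊ x) :
    op a b ∊ f ↔ b = app f a := by
  obtain ⟨c, hc, hc'⟩ := h.2 a ha
  simp only [pairMem_iff] at hc hc'
  have h1 : ∀ z, op a z ∊ f ↔ z = c := fun z => ⟨hc' z, fun h => h ▸ hc⟩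
  rw [app_eq h1, h1]

theorem IsFunction.app_mem {f x y a : M} (h : IsFunction f x y) (ha : a ∊ x) : app f a ∊ y := by
  obtain ⟨c, -, b, hb, hp⟩ := h.1 _ ((h.op_mem_iff ha).2 rfl)
  rw [eq_op_iff, op_inj] at hp
  exact hp.2 ▸ hb

theorem IsInjection.app_inj {f x y a b : M} (h : IsInjection f x y) (ha : a ∊ x) (hb : b ∊ x)
    (hab : app f a = app f b) : a = b := by
  refine h.2 a b (app f a) ?_
  rw [pairMem_iff, pairMem_iff, h.1.op_mem_iff ha, h.1.op_mem_iff hb]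
  exact ⟨rfl, hab⟩

/-- The graph of a definable function on a set. -/
theorem isInjection_graph {F : M → M} [DTerm F] {x y : M} (h : ∀ a, a ∊ x → F a ∊ y)
    (hi : ∀ a b, a ∊ x → b ∊ x → F a = F b → a = b) :
    IsInjection (img (fun a => op a (F a)) x) x y := by
  have key : ∀ a b : M, op a b ∊ img (fun a => op a (F a)) x ↔ a ∊ x ∧ b = F a := by
    intro a b
    rw [mem_img]
    constructor
    · rintro ⟨c, hc, h⟩
      obtain ⟨rfl, rfl⟩ := op_inj.1 h
      exact ⟨hc, rfl⟩
    · rintro ⟨ha, rfl⟩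
      exact ⟨a, ha, rfl⟩
  refine ⟨⟨fun p hp => ?_, fun a ha => ⟨F a, ?_⟩⟩, fun a b c => ?_⟩
  · obtain ⟨a, ha, rfl⟩ := mem_img.1 hp
    exact ⟨a, ha, F a, h a ha, eq_op_iff.2 rfl⟩
  · simp [pairMem_iff, key, ha]
  · rw [pairMem_iff, pairMem_iff, key, key]
    rintro ⟨⟨ha, rfl⟩, hb, hab⟩
    exact hi a b ha hb hab

theorem cardLE_of {F : M → M} [DTerm F] {x y : M} (h : ∀ a, a ∊ x → F a ∊ y)
    (hi : ∀ a b, a ∊ x → b ∊ x → F a = F b → a = b) : CardLE x y :=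
  ⟨_, isInjection_graph h hi⟩

theorem CardLE.of_sub {x y : M} (h : Sub x y) : CardLE x y :=
  cardLE_of (F := fun x => x) h fun _ _ _ _ h => h

theorem CardLE.trans {x y z : M} (h : CardLE x y) (h' : CardLE y z) : CardLE x z := by
  obtain ⟨f, hf⟩ := h
  obtain ⟨g, hg⟩ := h'
  refine cardLE_of (F := fun a => app g (app f a)) (fun a ha => hg.1.app_mem (hf.1.app_mem ha))
    fun a b ha hb hab => ?_
  exact hf.app_inj ha hb (hg.app_inj (hf.1.app_mem ha) (hf.1.app_mem hb) hab)

/-- Foundation for the pair `{x, y}`. -/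
theorem mem_asymm {x y : M} (h : x ∊ y) : ¬ y ∊ x := by
  intro h'
  obtain ⟨z, hz, hz'⟩ := ZFModel.foundation (pr x y) ⟨x, mem_pr.2 (Or.inl rfl)⟩
  rcases mem_pr.1 hz with rfl | rfl
  · exact hz' y (mem_pr.2 (Or.inr rfl)) h'
  · exact hz' x (mem_pr.2 (Or.inl rfl)) h

/-! ### Natural numbers -/

theorem isInductive_iff {w : M} : IsInductive w ↔ emp ∊ w ∧ ∀ x, x ∊ w → suc x ∊ w := by
  have h1 : ∀ e : M, (∀ z, ¬ z ∊ e) ↔ e = emp := fun e =>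
    ⟨fun h => ZFModel.ext _ _ fun z => iff_of_false (h z) not_mem_emp,
      fun h _ => h ▸ not_mem_emp⟩
  have h2 : ∀ s x : M, IsSucc s x ↔ s = suc x := fun s x =>
    ⟨fun h => ZFModel.ext _ _ fun z => (h z).trans mem_suc.symm, fun h _ => h ▸ mem_suc⟩
  simp [IsInductive, h1, h2]

theorem mem_om {z : M} : z ∊ (om : M) ↔ ∀ v, IsInductive v → z ∊ v := by
  refine mem_cls ?_
  obtain ⟨w, hw⟩ := ZFModel.exists_inductive (M := M)
  have : Dfn M (fun z : M => ∀ v, IsInductive v → z ∊ v) := by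
    simp only [isInductive_iff]
    infer_instance
  -- The intersection of all inductive sets is cut out of any one of them.
  obtain ⟨b, hb⟩ := ZFModel.exists_sep (fun z : M => ∀ v, IsInductive v → z ∊ v) w
  exact ⟨b, fun z => (hb z).trans ⟨fun h => h.2, fun h => ⟨h w hw, h⟩⟩⟩

theorem emp_mem_om : (emp : M) ∊ (om : M) := mem_om.2 fun _ hv => (isInductive_iff.1 hv).1

theorem suc_mem_om {n : M} (h : n ∊ (om : M)) : suc n ∊ (om : M) :=
  mem_om.2 fun v hv => (isInductive_iff.1 hv).2 n (mem_om.1 h v hv)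

theorem isInductive_om : IsInductive (om : M) :=
  isInductive_iff.2 ⟨emp_mem_om, fun _ => suc_mem_om⟩

theorem om_induction (P : M → Prop) [Dfn M P] (h0 : P emp)
    (hs : ∀ n, n ∊ (om : M) → P n → P (suc n)) {n : M} (hn : n ∊ (om : M)) : P n := by
  have : IsInductive (sep om P) := isInductive_iff.2 ⟨mem_sep.2 ⟨emp_mem_om, h0⟩, fun x hx =>
    mem_sep.2 ⟨suc_mem_om (mem_sep.1 hx).1, hs x (mem_sep.1 hx).1 (mem_sep.1 hx).2⟩⟩
  exact (mem_sep.1 (mem_om.1 hn _ this)).2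

theorem om_cases {n : M} (hn : n ∊ (om : M)) : n = emp ∨ ∃ k, k ∊ (om : M) ∧ n = suc k :=
  om_induction (fun n => n = emp ∨ ∃ k, k ∊ (om : M) ∧ n = suc k) (Or.inl rfl)
    (fun n hn _ => Or.inr ⟨n, hn, rfl⟩) hn

theorem suc_ne_emp (n : M) : suc n ≠ emp := fun h =>
  not_mem_emp (z := n) (h ▸ mem_suc.2 (Or.inr rfl))

theorem suc_inj {n m : M} (h : suc n = suc m) : n = m := by
  have h1 : n ∊ suc m := h ▸ mem_suc.2 (Or.inr rfl)
  have h2 : m ∊ suc n := h ▸ mem_suc.2 (Or.inr rfl)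
  rw [mem_suc] at h1 h2
  rcases h1 with h1 | h1
  · rcases h2 with h2 | h2
    · exact absurd h2 (mem_asymm h1)
    · exact h2.symm
  · exact h1

theorem om_trichotomy {n m : M} (hn : n ∊ (om : M)) (hm : m ∊ (om : M)) :
    n ∊ m ∨ n = m ∨ m ∊ n := by
  have h0 : ∀ m : M, m ∊ (om : M) → emp = m ∨ emp ∊ m := fun m hm =>
    om_induction (fun m : M => emp = m ∨ emp ∊ m) (Or.inl rfl) (fun m _ h => by
      rw [mem_suc]; tauto) hm
  have hs : ∀ n m : M, m ∊ (om : M) → n ∊ m → suc n = m ∨ suc n ∊ m := fun n m hm =>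
    om_induction (fun m : M => n ∊ m → suc n = m ∨ suc n ∊ m)
      (fun h => absurd h not_mem_emp) (fun m _ h hnm => by
        rcases mem_suc.1 hnm with h1 | rfl
        · rw [mem_suc]
          have := h h1
          tauto
        · exact Or.inl rfl) hm
  have key : ∀ m, m ∊ (om : M) → (n ∊ m ∨ n = m ∨ m ∊ n) := by
    refine om_induction (fun n : M => ∀ m, m ∊ (om : M) → (n ∊ m ∨ n = m ∨ m ∊ n)) ?_ ?_ hn
    · intro m hm
      have := h0 m hm
      tauto
    · intro n _ ih m hm
      rcases ih m hm with h | rfl | h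
      · have := hs n m hm h
        tauto
      · exact Or.inr (Or.inr (mem_suc.2 (Or.inr rfl)))
      · exact Or.inr (Or.inr (mem_suc.2 (Or.inl h)))
  exact key m hm

/-! ### Recursion on `ω` -/

/-- The `n`-th iterate of `G` at `a`. -/
noncomputable def iter (G : M → M) (a n : M) : M :=
  iota fun x => ∃ p, op n x ∊ p ∧ ∀ q, q ∊ p → q = op emp a ∨
    ∃ k z, op k z ∊ p ∧ q = op (suc k) (G z)

theorem dterm_iter {G : M → M} [hG : DTerm G] (a : M) : DTerm (iter G a) := by
  have : ∀ {Γ : Type u} [Ctx M Γ] (t : Γ → M) [DTerm t], DTerm (fun g => G (t g)) :=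
    fun t ht => dterm_unary hG ht
  change DTerm (fun n => iter G a n)
  unfold iter
  infer_instance

theorem iter_zero (G : M → M) (a : M) : iter G a emp = a := by
  refine iota_spec fun z => ⟨?_, ?_⟩
  · rintro ⟨p, hp, h⟩
    rcases h _ hp with h | ⟨k, z, -, h⟩
    · exact (op_inj.1 h).2
    · exact absurd (op_inj.1 h).1.symm (suc_ne_emp k)
  · rintro rfl
    exact ⟨pr (op emp z) (op emp z), mem_pr.2 (Or.inl rfl), fun q hq =>
      Or.inl ((mem_pr.1 hq).elim id id)⟩

/-- The witness `p` need not be a function: each of its pairs only has to be the initial one or to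
follow another pair of `p`. Induction on `n` gives uniqueness, since a pair at `suc n` must come
from one at `n`, and existence, by adjoining one pair. -/
theorem iter_spec {G : M → M} [hG : DTerm G] (a : M) {n : M} (hn : n ∊ (om : M)) :
    ∀ x, (∃ p, op n x ∊ p ∧ ∀ q, q ∊ p → q = op emp a ∨
      ∃ k z, op k z ∊ p ∧ q = op (suc k) (G z)) ↔ x = iter G a n := by
  have hG' : ∀ {Γ : Type u} [Ctx M Γ] (t : Γ → M) [DTerm t], DTerm (fun g => G (t g)) :=
    fun t ht => dterm_unary hG ht
  suffices h : ∃ y, ∀ x, (∃ p, op n x ∊ p ∧ ∀ q, q ∊ p → q = op emp a ∨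
      ∃ k z, op k z ∊ p ∧ q = op (suc k) (G z)) ↔ x = y by
    obtain ⟨y, hy⟩ := h
    rw [show iter G a n = y from iota_spec hy]
    exact hy
  refine om_induction (fun n => ∃ y, ∀ x, (∃ p, op n x ∊ p ∧ ∀ q, q ∊ p → q = op emp a ∨
      ∃ k z, op k z ∊ p ∧ q = op (suc k) (G z)) ↔ x = y) ?_ ?_ hn
  · refine ⟨a, fun z => ⟨?_, ?_⟩⟩
    · rintro ⟨p, hp, h⟩
      rcases h _ hp with h | ⟨k, z, -, h⟩
      · exact (op_inj.1 h).2
      · exact absurd (op_inj.1 h).1.symm (suc_ne_emp k)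
    · rintro rfl
      exact ⟨pr (op emp z) (op emp z), mem_pr.2 (Or.inl rfl), fun q hq =>
        Or.inl ((mem_pr.1 hq).elim id id)⟩
  · rintro n - ⟨y, hy⟩
    refine ⟨G y, fun x => ⟨?_, ?_⟩⟩
    · rintro ⟨p, hp, h⟩
      rcases h _ hp with h' | ⟨k, z, hkz, h'⟩
      · exact absurd (op_inj.1 h').1 (suc_ne_emp n)
      · obtain ⟨h1, rfl⟩ := op_inj.1 h'
        have := suc_inj h1
        subst this
        rw [(hy z).1 ⟨p, hkz, h⟩]
    · rintro rfl
      obtain ⟨p, hp, h⟩ := (hy y).2 rfl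
      refine ⟨un p (pr (op (suc n) (G y)) (op (suc n) (G y))),
        mem_un.2 (Or.inr (mem_pr.2 (Or.inl rfl))), fun q hq => ?_⟩
      rcases mem_un.1 hq with hq | hq
      · rcases h q hq with h | ⟨k, z, hkz, h⟩
        · exact Or.inl h
        · exact Or.inr ⟨k, z, mem_un.2 (Or.inl hkz), h⟩
      · exact Or.inr ⟨n, y, mem_un.2 (Or.inl hp), (mem_pr.1 hq).elim id id⟩

theorem iter_suc {G : M → M} [hG : DTerm G] (a : M) {n : M} (hn : n ∊ (om : M)) :
    iter G a (suc n) = G (iter G a n) := by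
  refine ((iter_spec a (suc_mem_om hn) _).1 ?_).symm
  obtain ⟨p, hp, h⟩ := (iter_spec (G := G) a hn _).2 rfl
  refine ⟨un p (pr (op (suc n) (G (iter G a n))) (op (suc n) (G (iter G a n)))),
    mem_un.2 (Or.inr (mem_pr.2 (Or.inl rfl))), fun q hq => ?_⟩
  rcases mem_un.1 hq with hq | hq
  · rcases h q hq with h | ⟨k, z, hkz, h⟩
    · exact Or.inl h
    · exact Or.inr ⟨k, z, mem_un.2 (Or.inl hkz), h⟩
  · exact Or.inr ⟨n, _, mem_un.2 (Or.inl hp), (mem_pr.1 hq).elim id id⟩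

end

/-! ### The cumulative hierarchy -/

section

variable {M : Type u} [setLang.Structure M] [ZFModel M]

/-- The set of all subsets of elements of `a`. -/
noncomputable def pot (a : M) : M := sUn (img pow a)

/-- `h` is the set of levels below some level. -/
def IsHistory (h : M) : Prop := ∀ x, x ∊ h → x = pot (sep x fun r => r ∊ h)

/-- `s` is a level of the cumulative hierarchy. -/
def IsLevel (s : M) : Prop := ∃ h, IsHistory h ∧ s = pot h

/-- The least level with the property `P`. -/
noncomputable def least (P : M → Prop) : M :=
  iota fun s => IsLevel s ∧ P s ∧ ∀ r, r ∊ s → IsLevel r → ¬ P r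

section

variable {Γ : Type u} [Ctx M Γ] {t : Γ → M} [DTerm t]

instance instDTermPot : DTerm (fun g => pot (t g)) := by
  unfold pot; infer_instance

instance instDfnIsHistory : Dfn M (fun g => IsHistory (t g)) := by
  unfold IsHistory; infer_instance

instance instDfnIsLevel : Dfn M (fun g => IsLevel (t g)) := by
  unfold IsLevel; infer_instance

instance instDfnIsLevelEta : Dfn M (IsLevel : M → Prop) := instDfnIsLevel (t := fun x => x)

instance instDTermLeast {P : Γ → M → Prop} [hP : Dfn M (fun p : Γ × M => P p.1 p.2)] :
    DTerm (fun g => least (P g)) := by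
  have h1 : Dfn M (fun p : (Γ × M) × M => P p.1.1 p.2) :=
    dfn_skip (P := fun q : Γ × M => P q.1 q.2) hP
  unfold least
  infer_instance

end

theorem mem_pot {a x : M} : x ∊ pot a ↔ ∃ c, c ∊ a ∧ Sub x c := by
  rw [pot, mem_sUn]
  constructor
  · rintro ⟨y, hy, hx⟩
    obtain ⟨c, hc, rfl⟩ := mem_img.1 hy
    exact ⟨c, hc, mem_pow.1 hx⟩
  · rintro ⟨c, hc, hx⟩
    exact ⟨pow c, mem_img.2 ⟨c, hc, rfl⟩, mem_pow.2 hx⟩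

theorem IsHistory.mem_iff {h c x : M} (hh : IsHistory h) (hc : c ∊ h) :
    x ∊ c ↔ ∃ d, d ∊ c ∧ d ∊ h ∧ Sub x d := by
  conv_lhs => rw [hh c hc, mem_pot]
  simp only [mem_sep, and_assoc]

/-- In an ∈-minimal counterexample `c`, a member `x` lies below some `d` in both `c` and `h`. Since
`d` is no counterexample, every `y ∊ x` is a subset of `d`, hence a member of `c`. -/
theorem IsHistory.sub_of_mem {h c x : M} (hh : IsHistory h) (hc : c ∊ h) (hx : x ∊ c) :
    Sub x c := by
  by_contra hn
  obtain ⟨c, hc, hmin⟩ := ZFModel.foundation (sep h fun c => ∃ x, x ∊ c ∧ ¬ Sub x c)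
    ⟨c, mem_sep.2 ⟨hc, x, hx, hn⟩⟩
  obtain ⟨hc, x, hx, hn⟩ := mem_sep.1 hc
  refine hn fun y hy => ?_
  obtain ⟨d, hdc, hdh, hxd⟩ := (hh.mem_iff hc).1 hx
  refine (hh.mem_iff hc).2 ⟨d, hdc, hdh, ?_⟩
  by_contra hyd
  exact hmin d (mem_sep.2 ⟨hdh, y, hxd y hy, hyd⟩) hdc

/-- The part of `h` in `c` is again a history: the members of `c` are subsets of `c`, so restricting
to `c` changes nothing below them. -/
theorem IsHistory.isLevel {h c : M} (hh : IsHistory h) (hc : c ∊ h) : IsLevel c := by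
  refine ⟨_, fun x hx => ?_, hh c hc⟩
  obtain ⟨hxc, hxh⟩ := mem_sep.1 hx
  conv_lhs => rw [hh x hxh]
  congr 1
  refine ZFModel.ext _ _ fun z => ?_
  simp only [mem_sep]
  exact ⟨fun h => ⟨h.1, hh.sub_of_mem hc hxc z h.1, h.2⟩, fun h => ⟨h.1, h.2.2⟩⟩

theorem IsLevel.mem_of_sub {s a b : M} (hs : IsLevel s) (hb : b ∊ s) (hab : Sub a b) : a ∊ s := by
  obtain ⟨h, -, rfl⟩ := hs
  obtain ⟨c, hc, hbc⟩ := mem_pot.1 hb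
  exact mem_pot.2 ⟨c, hc, fun z hz => hbc z (hab z hz)⟩

theorem IsLevel.exists_level {s a : M} (hs : IsLevel s) (ha : a ∊ s) :
    ∃ r, r ∊ s ∧ IsLevel r ∧ Sub a r := by
  obtain ⟨h, hh, rfl⟩ := hs
  obtain ⟨c, hc, hac⟩ := mem_pot.1 ha
  exact ⟨c, mem_pot.2 ⟨c, hc, fun _ => id⟩, hh.isLevel hc, hac⟩

theorem IsLevel.trans {s a x : M} (hs : IsLevel s) (ha : a ∊ s) (hx : x ∊ a) : x ∊ s := by
  obtain ⟨h, hh, rfl⟩ := hs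
  obtain ⟨c, hc, hac⟩ := mem_pot.1 ha
  exact mem_pot.2 ⟨c, hc, hh.sub_of_mem hc (hac x hx)⟩

theorem exists_minimal_level (P : M → Prop) [Dfn M P] {s : M} (hs : IsLevel s) (hP : P s) :
    ∃ s, IsLevel s ∧ P s ∧ ∀ r, r ∊ s → IsLevel r → ¬ P r := by
  by_cases h : ∃ t, t ∊ sep s fun t => IsLevel t ∧ P t
  · obtain ⟨t, ht, hmin⟩ := ZFModel.foundation _ h
    obtain ⟨hts, ht, hPt⟩ := mem_sep.1 ht
    exact ⟨t, ht, hPt, fun r hr hlr hPr =>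
      hmin r (mem_sep.2 ⟨hs.trans hts hr, hlr, hPr⟩) hr⟩
  · exact ⟨s, hs, hP, fun r hr hlr hPr => h ⟨r, mem_sep.2 ⟨hr, hlr, hPr⟩⟩⟩

/-- Take a minimal `s` unrelated to some level, then a minimal `t` unrelated to `s`. Each member of
one is a subset of a lower level, which by minimality is related to the other and must belong to it;
hence `s = t`. -/
theorem IsLevel.trichotomy {s t : M} (hs : IsLevel s) (ht : IsLevel t) :
    s ∊ t ∨ s = t ∨ t ∊ s := by
  by_contra hst
  obtain ⟨s, hs, ⟨t, ht, hst⟩, hsmin⟩ := exists_minimal_level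
    (fun s => ∃ t, IsLevel t ∧ ¬ (s ∊ t ∨ s = t ∨ t ∊ s)) hs ⟨t, ht, hst⟩
  obtain ⟨t, ht, hst, htmin⟩ := exists_minimal_level
    (fun t => ¬ (s ∊ t ∨ s = t ∨ t ∊ s)) ht hst
  refine hst (Or.inr (Or.inl (Sub.antisymm (fun a ha => ?_) fun a ha => ?_)))
  · obtain ⟨r, hrs, hr, har⟩ := hs.exists_level ha
    have hrt : r ∊ t ∨ r = t ∨ t ∊ r := by
      by_contra h
      exact hsmin r hrs hr ⟨t, ht, h⟩
    rcases hrt with h | rfl | h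
    · exact ht.mem_of_sub h har
    · exact absurd (Or.inr (Or.inr hrs)) hst
    · exact absurd (Or.inr (Or.inr (hs.trans hrs h))) hst
  · obtain ⟨r, hrt, hr, har⟩ := ht.exists_level ha
    rcases not_not.1 (htmin r hrt hr) with h | rfl | h
    · exact absurd (Or.inl (ht.trans hrt h)) hst
    · exact absurd (Or.inl hrt) hst
    · exact hs.mem_of_sub h har

theorem IsLevel.sub_total {s t : M} (hs : IsLevel s) (ht : IsLevel t) : Sub s t ∨ Sub t s := by
  rcases hs.trichotomy ht with h | rfl | h
  · exact Or.inl fun x hx => ht.trans h hx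
  · exact Or.inl fun _ => id
  · exact Or.inr fun x hx => hs.trans h hx

theorem least_spec (P : M → Prop) [Dfn M P] {s : M} (hs : IsLevel s) (hP : P s) :
    IsLevel (least P) ∧ P (least P) := by
  obtain ⟨s, hs, hP, hmin⟩ := exists_minimal_level P hs hP
  have : least P = s := iota_spec fun t => ⟨fun ⟨ht, hPt, htmin⟩ => by
    rcases hs.trichotomy ht with h | h | h
    · exact absurd hP (htmin s h hs)
    · exact h.symm
    · exact absurd hPt (hmin t h ht), fun h => h ▸ ⟨hs, hP, hmin⟩⟩
  rw [this]
  exact ⟨hs, hP⟩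

theorem exists_level_above (A : M) : ∃ s, IsLevel s ∧ ∀ r, r ∊ A → IsLevel r → r ∊ s := by
  -- The levels that belong to `A` or lie below one that does: a history because it is closed
  -- downwards.
  let h := sep (un A (sUn A)) fun r => IsLevel r ∧ ∃ t, t ∊ A ∧ IsLevel t ∧ (r = t ∨ r ∊ t)
  have hh : IsHistory h := by
    intro x hx
    obtain ⟨-, hx, t, htA, ht, hxt⟩ := mem_sep.1 hx
    refine ZFModel.ext _ _ fun a => ?_
    rw [mem_pot]
    constructor
    · intro ha
      obtain ⟨r, hrx, hr, har⟩ := hx.exists_level ha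
      have hrt : r ∊ t := by
        rcases hxt with rfl | hxt
        · exact hrx
        · exact ht.trans hxt hrx
      exact ⟨r, mem_sep.2 ⟨hrx, mem_sep.2 ⟨mem_un.2 (Or.inr (mem_sUn.2 ⟨t, htA, hrt⟩)), hr, t, htA,
        ht, Or.inr hrt⟩⟩, har⟩
    · rintro ⟨r, hr, har⟩
      exact hx.mem_of_sub (mem_sep.1 hr).1 har
  exact ⟨pot h, ⟨h, hh, rfl⟩, fun r hrA hr => mem_pot.2
    ⟨r, mem_sep.2 ⟨mem_un.2 (Or.inl hrA), hr, r, hrA, hr, Or.inl rfl⟩, fun _ => id⟩⟩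

theorem exists_level_of_forall {a : M} (h : ∀ x, x ∊ a → ∃ s, IsLevel s ∧ x ∊ s) :
    ∃ s, IsLevel s ∧ a ∊ s := by
  -- Least levels make the assignment a definable function, so replacement collects them without
  -- Choice.
  obtain ⟨s, hs, hs'⟩ := exists_level_above (img (fun x : M => least fun s => x ∊ s) a)
  obtain ⟨t, ht, ht'⟩ := exists_level_above (pr s s)
  refine ⟨t, ht, ht.mem_of_sub (ht' s (mem_pr.2 (Or.inl rfl)) hs) fun x hx => ?_⟩
  obtain ⟨r, hr, hxr⟩ := h x hx
  obtain ⟨h1, h2⟩ := least_spec (fun s => x ∊ s) hr hxr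
  exact hs.trans (hs' _ (mem_img.2 ⟨x, hx, rfl⟩) h1) h2

/-- The transitive closure: the union of the iterated unions of `{a}`. -/
theorem exists_transitive (a : M) : ∃ t, a ∊ t ∧ ∀ y, y ∊ t → Sub y t := by
  have := dterm_iter (G := sUn) (pr a a)
  refine ⟨sUn (img (iter sUn (pr a a)) om), mem_sUn.2 ⟨_, mem_img.2 ⟨emp, emp_mem_om, rfl⟩, ?_⟩,
    fun y hy x hx => ?_⟩
  · rw [iter_zero]
    exact mem_pr.2 (Or.inl rfl)
  · obtain ⟨_, h, hy⟩ := mem_sUn.1 hy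
    obtain ⟨n, hn, rfl⟩ := mem_img.1 h
    refine mem_sUn.2 ⟨_, mem_img.2 ⟨suc n, suc_mem_om hn, rfl⟩, ?_⟩
    rw [iter_suc _ hn]
    exact mem_sUn.2 ⟨y, hy, hx⟩

theorem exists_level_mem (a : M) : ∃ s, IsLevel s ∧ a ∊ s := by
  by_contra ha
  obtain ⟨t, hat, ht⟩ := exists_transitive a
  obtain ⟨y, hy, hmin⟩ := ZFModel.foundation (sep t fun y => ¬ ∃ s, IsLevel s ∧ y ∊ s)
    ⟨a, mem_sep.2 ⟨hat, ha⟩⟩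
  obtain ⟨hyt, hy⟩ := mem_sep.1 hy
  refine hy (exists_level_of_forall fun x hx => ?_)
  by_contra hxn
  exact hmin x (mem_sep.2 ⟨ht y hyt x hx, hxn⟩) hx

end

/-! ### Dedekind-finite sets and antichains of cardinals -/

section

variable {M : Type u} [setLang.Structure M] [ZFModel M]

variable (M) in
/-- Every countably infinite set has two distinct comparable elements. -/
def CompOmega : Prop :=
  ∀ x : M, (∃ w, (IsInductive w ∧ ∀ u, IsInductive u → Sub w u) ∧ ∃ f, IsBijection f x w) →
    ∃ y z, (y ∊ x ∧ z ∊ x) ∧ ¬ y = z ∧ (CardLE y z ∨ CardLE z y)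

/-- `CompOmega` excludes definable sequences of pairwise incomparable sets. -/
theorem CompOmega.not_antichain (hC : CompOmega M) (F : M → M) [DTerm F] :
    ¬ ∀ n m, n ∊ (om : M) → m ∊ (om : M) → n ≠ m → ¬ CardLE (F n) (F m) := by
  intro h
  have hinj : ∀ n m, n ∊ (om : M) → m ∊ (om : M) → F n = F m → n = m := by
    intro n m hn hm hnm
    by_contra hne
    exact h n m hn hm hne (hnm ▸ CardLE.of_sub fun _ => id)
  have hF : ∀ {Γ : Type u} [Ctx M Γ] (t : Γ → M) [DTerm t], DTerm (fun g => F (t g)) :=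
    fun t ht => dterm_unary ‹DTerm F› ht
  have key : ∀ n, n ∊ (om : M) → (iota fun k => k ∊ (om : M) ∧ F k = F n) = n := fun n hn =>
    iota_spec fun z => ⟨fun hz => hinj _ _ hz.1 hn hz.2, fun hz => by
      rw [hz]
      exact ⟨hn, rfl⟩⟩
  have hbij : ∃ f, IsBijection f (img F om) om := by
    refine ⟨_, isInjection_graph (F := fun x => iota fun k => k ∊ (om : M) ∧ F k = x)
      (fun a ha => ?_) (fun a b ha hb hab => ?_), fun n hn => ⟨F n, ?_⟩⟩
    · obtain ⟨n, hn, rfl⟩ := mem_img.1 ha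
      simpa only [key n hn] using hn
    · obtain ⟨n, hn, rfl⟩ := mem_img.1 ha
      obtain ⟨m, hm, rfl⟩ := mem_img.1 hb
      simp only [key n hn, key m hm] at hab
      rw [hab]
    · rw [pairMem_iff, mem_img]
      refine ⟨F n, mem_img.2 ⟨n, hn, rfl⟩, ?_⟩
      simp only [key n hn]
  obtain ⟨y, z, ⟨hy, hz⟩, hyz, hle⟩ := hC (img F om)
    ⟨om, ⟨isInductive_om, fun u hu z hz => mem_om.1 hz u hu⟩, hbij⟩
  obtain ⟨n, hn, rfl⟩ := mem_img.1 hy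
  obtain ⟨m, hm, rfl⟩ := mem_img.1 hz
  rcases hle with hle | hle
  · exact h n m hn hm (fun h => hyz (h ▸ rfl)) hle
  · exact h m n hm hn (fun h => hyz (h ▸ rfl)) hle

/-- An injection of `ω` into `s` would enumerate an infinite antichain. -/
theorem CompOmega.dedekindFinite (hC : CompOmega M) {s : M}
    (h : ∀ y z, y ∊ s → z ∊ s → y ≠ z → ¬ CardLE y z) : ¬ CardLE om s := by
  rintro ⟨f, hf⟩
  exact hC.not_antichain (app f) fun n m hn hm hnm =>
    h _ _ (hf.1.app_mem hn) (hf.1.app_mem hm) fun h => hnm (hf.app_inj hn hm h)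

/-- Injective self-maps of Dedekind-finite sets are surjective. -/
theorem surjective_of_dedekindFinite {s : M} (hs : ¬ CardLE om s) (G : M → M) [hG : DTerm G]
    (hmaps : ∀ x, x ∊ s → G x ∊ s) (hinj : ∀ x y, x ∊ s → y ∊ s → G x = G y → x = y) {y : M}
    (hy : y ∊ s) : ∃ x, x ∊ s ∧ G x = y := by
  by_contra hne
  have := dterm_iter (G := G) y
  have hi : ∀ {Γ : Type u} [Ctx M Γ] (t : Γ → M) [DTerm t], DTerm (fun g => iter G y (t g)) :=
    fun t ht => dterm_unary this ht
  have hmem : ∀ n, n ∊ (om : M) → iter G y n ∊ s := by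
    intro n hn
    refine om_induction (fun n => iter G y n ∊ s) ?_ (fun n hn ih => ?_) hn
    · simpa only [iter_zero] using hy
    · simpa only [iter_suc y hn] using hmaps _ ih
  refine hs (cardLE_of (F := iter G y) hmem fun n m hn hm => ?_)
  -- Cancelling `G` from an equality between iterates at different stages would exhibit `y` as a
  -- value of `G`.
  have key : ∀ m, m ∊ (om : M) → iter G y n = iter G y m → n = m := by
    refine om_induction (fun n => ∀ m, m ∊ (om : M) → iter G y n = iter G y m → n = m) ?_ ?_ hn
    · intro m hm h
      rcases om_cases hm with rfl | ⟨k, hk, rfl⟩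
      · rfl
      · rw [iter_zero, iter_suc y hk] at h
        exact absurd ⟨_, hmem k hk, h.symm⟩ hne
    · intro n hn ih m hm h
      rcases om_cases hm with rfl | ⟨k, hk, rfl⟩
      · rw [iter_zero, iter_suc y hn] at h
        exact absurd ⟨_, hmem n hn, h⟩ hne
      · rw [iter_suc y hn, iter_suc y hk] at h
        rw [ih k hk (hinj _ _ (hmem n hn) (hmem k hk) h)]
  exact key m hm

/-- Starting from `suc n` is what the final argument needs: the set added right after stage `n` is
still present at stage `m`. -/
theorem iter_mono {G : M → M} [DTerm G] (hG : ∀ x, Sub x (G x)) (a : M) {n m : M}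
    (hm : m ∊ (om : M)) (hnm : n ∊ m) :
    Sub (iter G a (suc n)) (iter G a m) := by
  have := dterm_iter (G := G) a
  have hi : ∀ {Γ : Type u} [Ctx M Γ] (t : Γ → M) [DTerm t], DTerm (fun g => iter G a (t g)) :=
    fun t ht => dterm_unary this ht
  refine om_induction (fun m => n ∊ m → Sub (iter G a (suc n)) (iter G a m)) ?_ ?_ hm hnm
  · exact fun h => absurd h not_mem_emp
  · intro m hm ih h
    rcases mem_suc.1 h with h | rfl
    · rw [iter_suc a hm]
      exact fun x hx => hG _ x (ih h x hx)
    · exact fun _ => id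

/-! ### Obstructions to embeddings -/

/-- If a Dedekind-finite set `D` embeds in the sum of `D' ⊆ D` and `T`, then its elements outside
`D'` start disjoint orbits, which end in `T`. -/
theorem cardLE_pow_of_orbits {D D' T U f : M} (hD : ¬ CardLE om D) (hDD : Sub D' D)
    (hinj : ∀ x y, x ∊ D → y ∊ D → app f x = app f y → x = y)
    (hmaps : ∀ x, x ∊ D → app f x ∊ D' ∨ ∃ t, t ∊ T ∧ app f x = pr U t) :
    CardLE (sep D fun x => ¬ x ∊ D') (pow T) := by
  -- The orbit of `y`, followed as long as `f` stays in `D'`, as an intersection of closed sets.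
  let O : M → M := fun y => sep D fun x =>
    ∀ c, y ∊ c → (∀ u, u ∊ c → u ∊ D → app f u ∊ D' → app f u ∊ c) → x ∊ c
  have hO : ∀ {Γ : Type u} [Ctx M Γ] (t : Γ → M) [DTerm t], DTerm (fun g => O (t g)) :=
    fun t ht => dterm_unary (G := O) inferInstance ht
  have hOD : ∀ {y x}, x ∊ O y → x ∊ D := fun h => (mem_sep.1 h).1
  have hOmem : ∀ {y x}, x ∊ O y → ∀ c, y ∊ c →
      (∀ u, u ∊ c → u ∊ D → app f u ∊ D' → app f u ∊ c) → x ∊ c := fun h => (mem_sep.1 h).2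
  have hself : ∀ {y}, y ∊ D → y ∊ O y := fun hy => mem_sep.2 ⟨hy, fun _ h _ => h⟩
  have hstep : ∀ {y x}, x ∊ O y → app f x ∊ D' → app f x ∊ O y := fun hx h =>
    mem_sep.2 ⟨hDD _ h, fun c hc hcl => hcl _ (hOmem hx c hc hcl) (hOD hx) h⟩
  have hex : ∀ {y}, y ∊ D → ¬ y ∊ D' → ∃ z, z ∊ O y ∧ ¬ app f z ∊ D' := by
    intro y hy hy'
    by_contra hne
    push Not at hne
    -- If the orbit never left `D'`, `f` would be an injective self-map of it, hence onto; then `y`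
    -- would be a value of `f` and lie in `D'`.
    have hfin : ¬ CardLE om (O y) := fun h => hD (h.trans (CardLE.of_sub fun _ => hOD))
    obtain ⟨x, hx, rfl⟩ := surjective_of_dedekindFinite hfin (app f)
      (fun x hx => hstep hx (hne x hx)) (fun x z hx hz => hinj x z (hOD hx) (hOD hz)) (hself hy)
    exact hy' (hne x hx)
  have hstart : ∀ {y y'}, y' ∊ D → y ∊ O y' → ¬ y ∊ D' → y = y' := by
    intro y y' hy' hy hn
    by_contra hne
    have := hOmem hy (sep D fun x => ¬ x = y) (mem_sep.2 ⟨hy', fun h => hne h.symm⟩)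
      fun u _ _ h => mem_sep.2 ⟨hDD _ h, fun h' => hn (h' ▸ h)⟩
    exact (mem_sep.1 this).2 rfl
  have hback : ∀ {u y}, y ∊ D → ¬ y ∊ D' → u ∊ D → app f u ∊ D' → app f u ∊ O y → u ∊ O y := by
    intro u y hy hn hu hfu hfO
    by_contra hne
    -- If `u` were outside the orbit, deleting `app f u` would leave a smaller closed set containing
    -- `y`, by injectivity of `f`.
    have := hOmem hfO (sep (O y) fun x => ¬ x = app f u)
      (mem_sep.2 ⟨hself hy, fun h => hn (h ▸ hfu)⟩) fun w hw hwD h =>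
        mem_sep.2 ⟨hstep (mem_sep.1 hw).1 h, fun h' =>
          hne (hinj w u hwD hu h' ▸ (mem_sep.1 hw).1)⟩
    exact (mem_sep.1 this).2 rfl
  have hdisj : ∀ {y y' z}, y ∊ D → ¬ y ∊ D' → y' ∊ D → ¬ y' ∊ D' → z ∊ O y → z ∊ O y' →
      y = y' := by
    intro y y' z hy hyn hy' hyn' hz hz'
    have := hOmem hz (sep D fun w => w ∊ O y' → y = y')
      (mem_sep.2 ⟨hy, fun h => hstart hy' h hyn⟩) fun u hu huD h =>
        mem_sep.2 ⟨hDD _ h, fun h' => (mem_sep.1 hu).2 (hback hy' hyn' huD h h')⟩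
    exact (mem_sep.1 this).2 hz'
  -- Sending `y` to the set of all its exits into `T` avoids proving that the exit is unique.
  refine cardLE_of (F := fun y => sep T fun t => ∃ z, z ∊ O y ∧ app f z = pr U t) (fun y _ =>
    mem_pow.2 fun t ht => (mem_sep.1 ht).1) fun y y' hy hy' h => ?_
  obtain ⟨hy, hyn⟩ := mem_sep.1 hy
  obtain ⟨hy', hyn'⟩ := mem_sep.1 hy'
  obtain ⟨z, hz, hzn⟩ := hex hy hyn
  obtain ⟨t, ht, hzt⟩ := (hmaps z (hOD hz)).resolve_left hzn
  have h1 : t ∊ sep T fun t => ∃ z, z ∊ O y' ∧ app f z = pr U t := by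
    rw [← h]
    exact mem_sep.2 ⟨ht, z, hz, hzt⟩
  obtain ⟨z', hz', hzt'⟩ := (mem_sep.1 h1).2
  have := hinj z z' (hOD hz) (hOD hz') (hzt.trans hzt'.symm)
  subst this
  exact hdisj hy hyn hy' hyn' hz hz'

/-- `ω × 𝒫(T)` does not embed in the sum of a Dedekind-finite set and `T`. -/
theorem not_injective_prod_pow {D T U V f : M} (hD : ¬ CardLE om D)
    (hinj : ∀ k c k' c', k ∊ (om : M) → c ∊ pow T → k' ∊ (om : M) → c' ∊ pow T →
      app f (pr V (op k c)) = app f (pr V (op k' c')) → op k c = op k' c')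
    (hmaps : ∀ k c, k ∊ (om : M) → c ∊ pow T →
      app f (pr V (op k c)) ∊ D ∨ ∃ t, t ∊ T ∧ app f (pr V (op k c)) = pr U t) : False := by
  have hex : ∀ c, c ∊ pow T → ∃ k t, k ∊ (om : M) ∧ t ∊ T ∧ app f (pr V (op k c)) = pr U t := by
    intro c hc
    by_contra hne
    refine hD (cardLE_of (F := fun k => app f (pr V (op k c))) (fun k hk => ?_)
      fun k k' hk hk' h => (op_inj.1 (hinj k c k' c hk hc hk' hc h)).1)
    exact (hmaps k c hk hc).resolve_right fun ⟨t, ht, h⟩ => hne ⟨k, t, hk, ht, h⟩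
  -- The diagonal set: a point `t` hit from row `c` is put in `S` when `t` is not in `c`.
  -- Injectivity makes `c` depend only on `t`, so the row of `S` itself gives a contradiction.
  let S := sep T fun t => ∃ c k, c ∊ pow T ∧ k ∊ (om : M) ∧ app f (pr V (op k c)) = pr U t ∧ ¬ t ∊ c
  have hS : S ∊ pow T := mem_pow.2 fun t ht => (mem_sep.1 ht).1
  obtain ⟨k, t, hk, ht, hkt⟩ := hex S hS
  have hn : ¬ t ∊ S := by
    intro h
    obtain ⟨-, c, k', hc, hk', hkt', htc⟩ := mem_sep.1 h
    have := (op_inj.1 (hinj k S k' c hk hS hk' hc (hkt.trans hkt'.symm))).2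
    exact htc (this ▸ h)
  exact hn (mem_sep.2 ⟨ht, S, k, hS, hk, hkt, hn⟩)

/-- A proper class all of whose subsets are Dedekind-finite contains sets outside `v` that do not
embed in `T`. -/
theorem exists_level_not_cardLE {X : M → Prop} [hX : Dfn M X]
    (hproper : ∀ s, ¬ ∀ y, y ∊ s ↔ X y)
    (hfin : ∀ s, (∀ x, x ∊ s → X x) → ¬ CardLE om s) (v T : M) :
    ∃ w, IsLevel w ∧ v ∊ w ∧ ¬ CardLE (sep w fun x => X x ∧ ¬ x ∊ v) T := by
  by_contra hne
  push Not at hne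
  have hX' : ∀ {Γ : Type u} [Ctx M Γ] (t : Γ → M) [DTerm t], Dfn M (fun g => X (t g)) :=
    fun t ht => dfn_unary hX ht
  let Y : M → M := fun w => sep w fun x => X x ∧ ¬ x ∊ v
  have hY : ∀ {Γ : Type u} [Ctx M Γ] (t : Γ → M) [DTerm t], DTerm (fun g => Y (t g)) :=
    fun t ht => dterm_unary (G := Y) inferInstance ht
  have hYX : ∀ w x, x ∊ Y w → X x := fun w x hx => (mem_sep.1 hx).2.1
  have hYmono : ∀ w w', Sub w w' → Sub (Y w) (Y w') := fun w w' h x hx =>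
    mem_sep.2 ⟨h x (mem_sep.1 hx).1, (mem_sep.1 hx).2⟩
  -- Two nested sets with the same image in `T` coincide: the first injection inverted after the
  -- second maps the larger set injectively into the smaller, and Dedekind-finiteness makes this map
  -- onto.
  have key : ∀ c s s' f f' : M, ¬ CardLE om s' → Sub s s' → IsInjection f s T →
      IsInjection f' s' T → (∀ z, z ∊ c ↔ ∃ x, x ∊ s ∧ z = app f x) →
      (∀ z, z ∊ c ↔ ∃ x, x ∊ s' ∧ z = app f' x) → Sub s' s := by
    intro c s s' f f' hs' hss hf hf' hc hc'
    let G : M → M := fun x => iota fun z => z ∊ s ∧ app f z = app f' x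
    have hG : ∀ x, x ∊ s' → G x ∊ s ∧ app f (G x) = app f' x := by
      intro x hx
      obtain ⟨z, hz, hxz⟩ := (hc _).1 ((hc' _).2 ⟨x, hx, rfl⟩)
      have : G x = z := iota_spec fun y =>
        ⟨fun hy => hf.app_inj hy.1 hz (hy.2.trans hxz), fun hy => hy ▸ ⟨hz, hxz.symm⟩⟩
      rw [this]
      exact ⟨hz, hxz.symm⟩
    intro y hy
    obtain ⟨x, hx, rfl⟩ := surjective_of_dedekindFinite hs' G (fun x hx => hss _ (hG x hx).1)
      (fun x z hx hz h => hf'.app_inj hx hz (by rw [← (hG x hx).2, ← (hG z hz).2, h])) hy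
    exact (hG x hx).1
  have : Dfn M (fun p : (M × M) × M => IsLevel p.2 ∧ p.1.2 = Y p.2 ∧ ∃ f, IsInjection f p.1.2 T ∧
    ∀ z, z ∊ p.1.1 ↔ ∃ x, x ∊ p.1.2 ∧ z = app f x) := inferInstance
  -- A subset of `T` thus determines the `Y w` of which it is an injective image. If every such `Y
  -- w` embedded in `T`, replacement on `pow T` would collect them all, and `X` would be a set.
  obtain ⟨b, hb⟩ := ZFModel.exists_repl (fun c s => ∃ w, IsLevel w ∧ s = Y w ∧
    ∃ f, IsInjection f s T ∧ ∀ z, z ∊ c ↔ ∃ x, x ∊ s ∧ z = app f x) (pow T) (by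
      rintro c - _ _ ⟨w, hw, rfl, f, hf, hc⟩ ⟨w', hw', rfl, f', hf', hc'⟩
      rcases hw.sub_total hw' with h | h
      · exact (key c _ _ f' f (hfin _ (hYX w)) (key c _ _ f f' (hfin _ (hYX w')) (hYmono _ _ h) hf
          hf' hc hc') hf' hf hc' hc).antisymm
          (key c _ _ f f' (hfin _ (hYX w')) (hYmono _ _ h) hf hf' hc hc') |>.symm ▸ rfl
      · exact (hYmono _ _ h).antisymm
          (key c _ _ f' f (hfin _ (hYX w)) (hYmono _ _ h) hf' hf hc' hc))
  refine hproper (sep (un v (sUn b)) X) fun x => ⟨fun hx => (mem_sep.1 hx).2, fun hx =>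
    mem_sep.2 ⟨?_, hx⟩⟩
  by_cases hxv : x ∊ v
  · exact mem_un.2 (Or.inl hxv)
  obtain ⟨s, hs, hxs⟩ := exists_level_mem x
  obtain ⟨t, ht, hvt⟩ := exists_level_mem v
  obtain ⟨w, hw, hw'⟩ := exists_level_above (pr s t)
  obtain ⟨f, hf⟩ := hne w hw (hw.trans (hw' t (mem_pr.2 (Or.inr rfl)) ht) hvt)
  refine mem_un.2 (Or.inr (mem_sUn.2 ⟨Y w, (hb _).2 ⟨img (app f) (Y w), mem_pow.2 ?_, w, hw, rfl,
    f, hf, fun z => mem_img⟩, mem_sep.2 ⟨?_, hx, hxv⟩⟩))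
  · intro z hz
    obtain ⟨a, ha, rfl⟩ := mem_img.1 hz
    exact hf.1.app_mem ha
  · exact hw.trans (hw' s (mem_pr.2 (Or.inl rfl)) hs) hxs

/-- Under `CompOmega`, a class of pairwise incomparable sets is a set. -/
theorem CompOmega.exists_comparable (hC : CompOmega M) {X : M → Prop} [hX : Dfn M X]
    (hproper : ∀ s, ¬ ∀ y, y ∊ s ↔ X y) : ∃ y z, X y ∧ X z ∧ y ≠ z ∧ CardLE y z := by
  by_contra hanti
  have hX' : ∀ {Γ : Type u} [Ctx M Γ] (t : Γ → M) [DTerm t], Dfn M (fun g => X (t g)) :=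
    fun t ht => dfn_unary hX ht
  have hfin : ∀ s, (∀ x, x ∊ s → X x) → ¬ CardLE om s := fun s hs =>
    hC.dedekindFinite fun y z hy hz hyz hle => hanti ⟨y, z, hs y hy, hs z hz, hyz, hle⟩
  let GT : M → M := fun t => un t (prod om (pow t))
  let T : M → M := iter GT emp
  have hT : ∀ {Γ : Type u} [Ctx M Γ] (t : Γ → M) [DTerm t], DTerm (fun g => T (t g)) :=
    fun t ht => dterm_unary (dterm_iter (G := GT) emp) ht
  have hTmono : ∀ {n m}, m ∊ (om : M) → n ∊ m → Sub (T (suc n)) (T m) :=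
    iter_mono (G := GT) (fun x z hz => mem_un.2 (Or.inl hz)) emp
  let Tinf := sUn (img (fun n => T n) om)
  -- The bound `pow Tinf` is fixed in advance, so one choice of `W (suc n)` serves against every
  -- later `m`.
  let GW : M → M := fun v => least fun w => v ∊ w ∧ ¬ CardLE (sep w fun x => X x ∧ ¬ x ∊ v) (pow Tinf)
  have hGW : ∀ v, IsLevel (GW v) ∧ v ∊ GW v ∧
      ¬ CardLE (sep (GW v) fun x => X x ∧ ¬ x ∊ v) (pow Tinf) := by
    intro v
    obtain ⟨w, hw, hw'⟩ := exists_level_not_cardLE hproper hfin v (pow Tinf)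
    exact least_spec (fun w => v ∊ w ∧ ¬ CardLE (sep w fun x => X x ∧ ¬ x ∊ v) (pow Tinf)) hw hw'
  let W : M → M := iter GW emp
  have hW : ∀ {Γ : Type u} [Ctx M Γ] (t : Γ → M) [DTerm t], DTerm (fun g => W (t g)) :=
    fun t ht => dterm_unary (dterm_iter (G := GW) emp) ht
  have hGWsub : ∀ x, Sub x (GW x) := fun x z hz => (hGW x).1.trans (hGW x).2.1 hz
  have hWmono : ∀ {n m}, m ∊ (om : M) → n ∊ m → Sub (W (suc n)) (W m) :=
    iter_mono (G := GW) hGWsub emp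
  have hWsuc : ∀ {n}, n ∊ (om : M) → W (suc n) = GW (W n) := iter_suc (G := GW) emp
  let U := sep (sUn (img (fun n => W n) om)) X
  have hUX : ∀ x, x ∊ U → X x := fun x hx => (mem_sep.1 hx).2
  let D : M → M := fun n => sep U fun x => ¬ x ∊ W n
  have hDfin : ∀ n, ¬ CardLE om (D n) := fun n => hfin _ fun x hx => hUX x (mem_sep.1 hx).1
  have hD : ∀ {Γ : Type u} [Ctx M Γ] (t : Γ → M) [DTerm t], DTerm (fun g => D (t g)) :=
    fun t ht => dterm_unary (G := D) inferInstance ht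
  -- The tag makes the sum disjoint, as `U` belongs to `pr U t` and so `pr U t` is not in `U`.
  let B : M → M := fun n => un (D n) (img (fun t => pr U t) (T n))
  have hB : ∀ {n x}, x ∊ B n ↔ x ∊ D n ∨ ∃ t, t ∊ T n ∧ x = pr U t := fun {n x} => by
    rw [mem_un, mem_img]
  refine hC.not_antichain B fun n m hn hm hnm => ?_
  rcases om_trichotomy hn hm with h | h | h
  · rintro ⟨f, hf⟩
    have hlt : ¬ CardLE (sep (W (suc n)) fun x => X x ∧ ¬ x ∊ W n) (pow Tinf) := by
      rw [hWsuc hn]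
      exact (hGW (W n)).2.2
    have hWnm : Sub (W n) (W m) := fun x hx => hWmono hm h x (by
      rw [hWsuc hn]
      exact hGWsub _ x hx)
    have horb : CardLE (sep (D n) fun x => ¬ x ∊ D m) (pow (T m)) :=
      cardLE_pow_of_orbits (U := U) (f := f) (hDfin n)
        (fun x hx => mem_sep.2 ⟨(mem_sep.1 hx).1, fun h => (mem_sep.1 hx).2 (hWnm x h)⟩)
        (fun x y hx hy => hf.app_inj (hB.2 (Or.inl hx)) (hB.2 (Or.inl hy)))
        (fun x hx => hB.1 (hf.1.app_mem (hB.2 (Or.inl hx))))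
    -- Since `W (suc n)` is included in `W m`, the whole block between `W n` and `W (suc n)` lies in
    -- `D n` outside `D m`.
    refine hlt ((CardLE.trans (CardLE.of_sub fun x hx => ?_) horb).trans (CardLE.of_sub ?_))
    · obtain ⟨hx, hxX, hxn⟩ := mem_sep.1 hx
      exact mem_sep.2 ⟨mem_sep.2 ⟨mem_sep.2 ⟨mem_sUn.2 ⟨_, mem_img.2 ⟨suc n, suc_mem_om hn, rfl⟩,
        hx⟩, hxX⟩, hxn⟩, fun h' => (mem_sep.1 h').2 (hWmono hm h x hx)⟩
    · exact fun c hc => mem_pow.2 fun t ht =>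
        mem_sUn.2 ⟨_, mem_img.2 ⟨m, hm, rfl⟩, mem_pow.1 hc t ht⟩
  · exact absurd h hnm
  · rintro ⟨f, hf⟩
    -- Now `m` precedes `n`, so `T n` includes `T (suc m)` and with it `ω × 𝒫(T m)`.
    have hmem : ∀ k c, k ∊ (om : M) → c ∊ pow (T m) → pr U (op k c) ∊ B n := by
      intro k c hk hc
      refine hB.2 (Or.inr ⟨_, hTmono hn h _ ?_, rfl⟩)
      rw [show T (suc m) = GT (T m) from iter_suc (G := GT) emp hm]
      exact mem_un.2 (Or.inr (mem_prod.2 ⟨k, hk, c, hc, rfl⟩))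
    exact not_injective_prod_pow (D := D m) (T := T m) (U := U) (V := U) (f := f) (hDfin m)
      (fun k c k' c' hk hc hk' hc' h =>
        pr_inj (hf.app_inj (hmem k c hk hc) (hmem k' c' hk' hc') h))
      fun k c hk hc => hB.1 (hf.1.app_mem (hmem k c hk hc))

/-! ### Back to first-order sentences -/

theorem compOmega_of_models (h : M ⊨ compOmega) : CompOmega M := by
  have h : BoundedFormula.Realize (M := M) compOmega default default := h
  simpa only [CompOmega, compOmega, realize_all, realize_ex, realize_mem, realize_eq, realize_comparable,
    realize_cardEqAlephZero, BoundedFormula.realize_imp, BoundedFormula.realize_inf,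
    BoundedFormula.realize_not, snoc_up, snoc_last] using h

end

end FirstOrderZF

theorem mainTheorem8 (φ : FirstOrderZF.setLang.Formula (Fin 1)) :
    FirstOrderZF.ZF ⊨ᵇ
      (FirstOrderZF.isProperClass φ ⟹ (FirstOrderZF.compOmega ⟹ FirstOrderZF.compClass φ) :
        FirstOrderZF.setLang.Sentence) := by
  open FirstOrderZF in
  refine Theory.models_sentence_iff.2 fun M => ?_
  have : ZFModel M := zfModel_of_models M.is_model
  have hdef : ∀ (v : Empty → M) (xs : Fin 0 → M), BoundedFormula.Realize (M := M) (isProperClass φ) v xs ↔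
      ∀ s : M, ¬ ∀ y, y ∊ s ↔ φ.Realize ![y] := by
    intro v xs
    have hv : ∀ x y : M, (fun a : Fin 1 => (Fin.snoc (Fin.snoc xs x : Fin 1 → M) y : Fin 2 → M)
        ((![Fin.last 1] : Fin 1 → Fin 2) a)) = ![y] := fun x y => funext fun i => by
      rw [Subsingleton.elim i 0]
      exact snoc_last y
    simp only [isProperClass, realize_all, realize_mem, realize_inst, BoundedFormula.realize_iff,
      BoundedFormula.realize_not, snoc_up, snoc_last, hv]
  change BoundedFormula.Realize _ default default
  rw [BoundedFormula.realize_imp, BoundedFormula.realize_imp, hdef]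
  intro hproper hC
  have := dfn_formula (M := M) φ
  obtain ⟨y, z, hy, hz, hyz, hle⟩ :=
    (compOmega_of_models hC).exists_comparable (X := fun x => φ.Realize ![x]) hproper
  rw [compClass, BoundedFormula.realize_imp]
  intro _
  simp only [realize_ex, realize_inst, realize_eq, realize_comparable, BoundedFormula.realize_inf,
    BoundedFormula.realize_not, snoc_up, snoc_last]
  refine ⟨y, z, ⟨?_, ?_⟩, hyz, Or.inl hle⟩
  · convert hy using 2
    rename_i i
    rw [Subsingleton.elim i 0]
    exact (snoc_up _ _).trans (snoc_last _)
  · convert hz using 2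
    rename_i i
    rw [Subsingleton.elim i 0]
    exact snoc_last _
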